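/- Let $V$ be a finite-dimensional real inner product space and let $W$ be a finite real reflection group on $V$, i.e. a finite group of isometries of $V$ generated by reflections. Let $\Phi$ be a root system for $W$: a $W$-stable set of nonzero vectors consisting of exactly one opposite pair $\{\pm\alpha\}$ of normals to each reflecting hyperplane of $W$ (no integrality is assumed). Fix a chamber $C$ (a connected component of the complement of the reflecting hyperplanes), let $\Phi_+$ be the set of roots having positive inner product with the points of $C$, let $S$ be the set of reflections in the corresponding simple roots (the positive roots that are not nonnegative combinations of the other positive roots), and let $\ell_S$ be the word length with respect to $S$. Let $I$ be the ideal of the polynomial algebra $\mathrm{Sym}(V_{\mathbb C}^*)$ generated by the $W$-invariants without constant term, so that $\mathrm{Sym}(V_{\mathbb C}^*)/I$ is the graded coinvariant algebra. For a $W$-orbit $\Phi'\subseteq\Phi$ let $$f^{\Phi'}(q)=\sum_{d\ge 0}\dim_{\mathbb C}\mathrm{Hom}_W\bigl(\mathbb C\Phi',(\mathrm{Sym}(V_{\mathbb C}^*)/I)_d\bigr)\,q^d$$ be the fake degree of the permutation representation $\mathbb C\Phi'$ of $W$. Then $\Phi'$ contains a unique dominant element $\alpha_0$, i.e. a unique element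 of $\overline C$. Its isotropy group $W_{\alpha_0}=\{w\in W: w(\alpha_0)=\alpha_0\}$ is generated by a subset of $S$, and for every $\alpha\in\Phi'$ the coset $\{u\in W:u(\alpha_0)=\alpha\}$ of $W_{\alpha_0}$ has a unique element of minimal length; let $d(\alpha_0,\alpha)$ be that length. Moreover $$f^{\Phi'}(q)=\sum_{\alpha\in\Phi'}q^{d(\alpha_0,\alpha)},$$ and equivalently $$f^{\Phi'}(q)=\frac{\sum_{w\in W}q^{\ell_S(w)}}{\sum_{w\in W_{\alpha_0}}q^{\ell_S(w)}}.$$ -/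

import Mathlib

namespace FakeDegree

open scoped InnerProductSpace Polynomial

noncomputable section

section Geometry

variable {V : Type*} [NormedAddCommGroup V] [InnerProductSpace ℝ V]

/-- The orthogonal group `O(V)` acts on `V` by evaluation. -/
instance isometryAction : MulAction (V ≃ₗᵢ[ℝ] V) V where
  smul g v := g v
  one_smul _ := rfl
  mul_smul _ _ _ := rfl

theorem isometry_smul_def (g : V ≃ₗᵢ[ℝ] V) (v : V) : g • v = g v := rfl

/-- The orthogonal reflection fixing the hyperplane normal to `v` (for `v ≠ 0`). -/
def refl (v : V) : V ≃ₗᵢ[ℝ] V := (ℝ ∙ v)ᗮ.reflection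

/-- A finite real reflection group: a finite group of isometries generated by the
(hyperplane) reflections that it contains. -/
structure IsFiniteReflectionGroup (W : Subgroup (V ≃ₗᵢ[ℝ] V)) : Prop where
  finite : Finite W
  generated : Subgroup.closure {r | r ∈ W ∧ ∃ v : V, v ≠ 0 ∧ r = refl v} = W

/-- `Φ` is a root system of `W`: a `W`-stable set of normals to the reflecting hyperplanes
of `W`, with exactly one opposite pair `{β, -β}` of normals for every reflecting hyperplane.
No integrality (crystallographic) condition is imposed. -/
structure IsRootSystemOf (W : Subgroup (V ≃ₗᵢ[ℝ] V)) (Φ : Set V) : Prop where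
  ne_zero : ∀ α ∈ Φ, α ≠ 0
  refl_mem : ∀ α ∈ Φ, refl α ∈ W
  stable : ∀ w ∈ W, ∀ α ∈ Φ, w • α ∈ Φ
  pair : ∀ v : V, v ≠ 0 → refl v ∈ W → ∃ β : V, Φ ∩ (ℝ ∙ v : Submodule ℝ V) = {β, -β}

/-- The complement of the union of the hyperplanes normal to the roots. -/
def hyperplaneComplement (Φ : Set V) : Set V := {v | ∀ α ∈ Φ, ⟪α, v⟫_ℝ ≠ 0}

/-- The chambers: the connected components of the complement of the hyperplanes. -/
def IsChamber (Φ C : Set V) : Prop :=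
  ∃ x ∈ hyperplaneComplement Φ, C = connectedComponentIn (hyperplaneComplement Φ) x

/-- The positive roots with respect to the dominant chamber `C`. -/
def positiveRoots (Φ C : Set V) : Set V := {α | α ∈ Φ ∧ ∀ v ∈ C, 0 < ⟪α, v⟫_ℝ}

/-- The simple roots: the positive roots that are not nonnegative linear combinations of the
other positive roots. -/
def simpleRoots (Φ C : Set V) : Set V :=
  {α | α ∈ positiveRoots Φ C ∧ α ∉ Submodule.span NNReal (positiveRoots Φ C \ {α})}

/-- The simple reflections. -/
def simpleReflections (Φ C : Set V) : Set (V ≃ₗᵢ[ℝ] V) := refl '' simpleRoots Φ C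

end Geometry

section Length

variable {G : Type*} [Group G]

/-- The length of `w` with respect to `S`: the least number of factors in an expression of `w`
as a product of elements of `S`. -/
def wordLength (S : Set G) (w : G) : ℕ :=
  sInf {n | ∃ l : List G, l.length = n ∧ (∀ s ∈ l, s ∈ S) ∧ l.prod = w}

/-- The length generating function of `H` with respect to `S`, `∑_{w ∈ H} q ^ ℓ_S(w)`. -/
def lengthPolynomial (S : Set G) (H : Subgroup G) : ℤ[X] := ∑ᶠ w ∈ H, Polynomial.X ^ wordLength S w

/-- The least length of an element `w` of `W` with `w(x) = y`, that is, of an element of the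
coset `{u ∈ W : u(x) = y}` of the stabilizer of `x` in `W`. -/
def minLength {A : Type*} [MulAction G A] (S : Set G) (W : Subgroup G) (x y : A) : ℕ :=
  sInf (wordLength S '' {w | w ∈ W ∧ w • x = y})

/-- The isotropy subgroup of `x` in `W`, as a subgroup of the ambient group. -/
def isotropy {A : Type*} [MulAction G A] (W : Subgroup G) (x : A) : Subgroup G :=
  W ⊓ MulAction.stabilizer G x

end Length

section Coinvariants

variable {V : Type*} [NormedAddCommGroup V] [InnerProductSpace ℝ V]
  {ι : Type*} [Fintype ι] (b : Module.Basis ι ℝ V)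

/-- The action of `w` on polynomial functions, `(w f)(v) = f(w⁻¹ v)`, where the variable `X i`
is the `i`-th coordinate function with respect to the basis `b` (extended to the
complexification of `V`). Thus `MvPolynomial ι ℂ` is `Sym(V*)` for the complexified `V`. -/
def polyAct (w : V ≃ₗᵢ[ℝ] V) : MvPolynomial ι ℂ →ₐ[ℂ] MvPolynomial ι ℂ :=
  MvPolynomial.aeval fun i =>
    ∑ j, MvPolynomial.C ((b.repr (w⁻¹ (b j)) i : ℝ) : ℂ) * MvPolynomial.X j

theorem polyAct_one : polyAct b 1 = AlgHom.id ℂ _ := by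
  classical
  ext1 i
  simp [polyAct, Finsupp.single_apply, apply_ite]

theorem polyAct_mul (w u : V ≃ₗᵢ[ℝ] V) :
    polyAct b (w * u) = (polyAct b w).comp (polyAct b u) := by
  ext1 i
  have key : ∀ j, b.repr ((w * u)⁻¹ (b j)) i
      = ∑ k, b.repr (u⁻¹ (b k)) i * b.repr (w⁻¹ (b j)) k := by
    intro j
    have h : (w * u)⁻¹ (b j) = u⁻¹ (∑ k, b.repr (w⁻¹ (b j)) k • b k) := by
      rw [b.sum_repr, mul_inv_rev]; rfl
    rw [h, map_sum, map_sum, Finsupp.finsetSum_apply]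
    exact Finset.sum_congr rfl fun k _ => by
      rw [map_smul, map_smul, Finsupp.smul_apply, smul_eq_mul, mul_comm]
  simp only [polyAct, MvPolynomial.aeval_X, AlgHom.comp_apply, map_sum, map_mul, key,
    MvPolynomial.algHom_C, MvPolynomial.algebraMap_eq, Complex.ofReal_sum, Complex.ofReal_mul,
    Finset.sum_mul, Finset.mul_sum]
  rw [Finset.sum_comm]
  simp only [mul_assoc]

/-- The ideal `I` generated by the `W`-invariant polynomials without constant term. -/
def invariantIdeal (W : Subgroup (V ≃ₗᵢ[ℝ] V)) : Ideal (MvPolynomial ι ℂ) :=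
  Ideal.span {f | (∀ w ∈ W, polyAct b w f = f) ∧ MvPolynomial.constantCoeff f = 0}

theorem invariantIdeal_le_comap (W : Subgroup (V ≃ₗᵢ[ℝ] V)) (w : W) :
    invariantIdeal b W ≤ (invariantIdeal b W).comap (polyAct b w) := by
  refine Ideal.span_le.2 fun f hf => ?_
  change polyAct b w f ∈ invariantIdeal b W
  rw [hf.1 w w.2]
  exact Ideal.subset_span hf

/-- The coinvariant algebra `S/I`. -/
abbrev Coinvariant (W : Subgroup (V ≃ₗᵢ[ℝ] V)) : Type _ :=
  MvPolynomial ι ℂ ⧸ invariantIdeal b W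

/-- The representation of `W` on the coinvariant algebra. -/
def coinvariantRep (W : Subgroup (V ≃ₗᵢ[ℝ] V)) : Representation ℂ W (Coinvariant b W) where
  toFun w := (Ideal.quotientMapₐ (invariantIdeal b W) (polyAct b (w : V ≃ₗᵢ[ℝ] V))
    (invariantIdeal_le_comap b W w)).toLinearMap
  map_one' := by
    refine LinearMap.ext fun x => ?_
    obtain ⟨f, rfl⟩ := Ideal.Quotient.mk_surjective x
    simp [polyAct_one]
  map_mul' w u := by
    refine LinearMap.ext fun x => ?_
    obtain ⟨f, rfl⟩ := Ideal.Quotient.mk_surjective x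
    simp [polyAct_mul]

/-- The homogeneous component of degree `d` of the coinvariant algebra. -/
def coinvariantDegree (W : Subgroup (V ≃ₗᵢ[ℝ] V)) (d : ℕ) : Submodule ℂ (Coinvariant b W) :=
  (MvPolynomial.homogeneousSubmodule ι ℂ d).map
    (Ideal.Quotient.mkₐ ℂ (invariantIdeal b W)).toLinearMap

/-- The degree `d` part of `Hom_W(U, S/I)`: the `W`-equivariant linear maps from `U` into the
degree `d` component of the coinvariant algebra. -/
def equivariantHom (W : Subgroup (V ≃ₗᵢ[ℝ] V)) {U : Type*} [AddCommGroup U] [Module ℂ U]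
    (ρ : Representation ℂ W U) (d : ℕ) : Submodule ℂ (U →ₗ[ℂ] Coinvariant b W) where
  carrier := {φ | (∀ w, φ ∘ₗ ρ w = coinvariantRep b W w ∘ₗ φ) ∧
    ∀ u, φ u ∈ coinvariantDegree b W d}
  add_mem' := by
    rintro φ ψ ⟨h₁, h₂⟩ ⟨h₃, h₄⟩
    exact ⟨fun w => by rw [LinearMap.add_comp, LinearMap.comp_add, h₁, h₃],
      fun u => Submodule.add_mem _ (h₂ u) (h₄ u)⟩
  zero_mem' := ⟨fun w => by simp, fun u => by simp⟩
  smul_mem' := by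
    rintro c φ ⟨h₁, h₂⟩
    exact ⟨fun w => by rw [LinearMap.smul_comp, LinearMap.comp_smul, h₁],
      fun u => Submodule.smul_mem _ c (h₂ u)⟩

/-- The fake degree of a finite-dimensional representation `U` of `W`: the Hilbert series of
the graded vector space `Hom_W(U, S/I)`. -/
def fakeDegree (W : Subgroup (V ≃ₗᵢ[ℝ] V)) {U : Type*} [AddCommGroup U] [Module ℂ U]
    (ρ : Representation ℂ W U) : PowerSeries ℤ :=
  PowerSeries.mk fun d => (Module.finrank ℂ (equivariantHom b W ρ d) : ℤ)

/-- The fake degree of the permutation representation of `W` on the orbit of `β`. -/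
def orbitFakeDegree (W : Subgroup (V ≃ₗᵢ[ℝ] V)) (β : V) : PowerSeries ℤ :=
  fakeDegree b W (Representation.ofMulAction ℂ W (MulAction.orbit W β))

end Coinvariants

end

end FakeDegree

/-! Write S for the polynomial algebra, let ξ be the dominant point of the orbit Φ', W_ξ its
isotropy group, and n_d the number of orbit points whose coset of W_ξ has minimal length d. The
heart of the matter is dim Hom_W(ℂΦ', (S/I)_d) = n_d. It follows from two estimates that need
neither Chevalley's theorem nor the dimension of S/I.

Upper bound. The divided differences (f - s_α f)/α are linear over the invariants, so the constant
term after a word of them is a functional on S/I (`constantCoeff_wordOperator`), and in degree d the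
words of length d jointly detect membership in I (`mem_invariantIdeal`). The operator of a word
depends only on the product and length of the word and vanishes if the word is not reduced
(`exists_operator`). An equivariant map is determined by its value at ξ, which lifts to a
W_ξ-invariant polynomial. A reduced word whose product is not a minimal coset representative can be
rewritten to end in a simple reflection of W_ξ, and this letter kills the lift. Thus n_d functionals
suffice (`detect_injective`).

Lower bound. Evaluate W_ξ-invariant polynomials on the W-orbit of a regular point x. Every function
on Φ' arises this way, so the filtration of ℂ^Φ' by degree is exhaustive. A W_ξ-invariant of degree
d lying in I yields only values already obtained in lower degree, because W-invariants are constant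
on Wx (`orbitEval_average_mem`). So the d-th step has dimension at most dim Hom_d, and |Φ'| ≤ ∑ dim
Hom_d ≤ ∑ n_d ≤ |Φ'| forces equality in every degree (`finrank_orbitHom`).

The product formula then says that lengths add along w = (minimal representative)·(element of W_ξ),
a consequence of strong exchange (`wordLength_mul_of_minimal`). -/

namespace FakeDegree

open scoped InnerProductSpace Polynomial

/-! ### Reflections and coroot pairings. -/

section Reflections

variable {V : Type*} [NormedAddCommGroup V] [InnerProductSpace ℝ V]

/-- The pairing `⟨u, v^∨⟩` of a vector with a coroot. -/
noncomputable def corootPairing (v u : V) : ℝ := 2 * ⟪v, u⟫_ℝ / ⟪v, v⟫_ℝ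

theorem refl_apply (v u : V) : refl v u = u - corootPairing v u • v := by
  rw [refl, Submodule.reflection_orthogonal_apply, Submodule.reflection_singleton_apply,
    corootPairing, real_inner_self_eq_norm_sq, neg_sub, two_smul, ← add_smul]
  congr 2
  simp only [RCLike.ofReal_real_eq_id, id]
  ring

theorem corootPairing_self {v : V} (hv : v ≠ 0) : corootPairing v v = 2 := by
  have : ⟪v, v⟫_ℝ ≠ 0 := inner_self_ne_zero.2 hv
  rw [corootPairing]; field_simp

theorem corootPairing_neg (v u : V) : corootPairing (-v) u = -corootPairing v u := by
  simp [corootPairing, neg_div]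

theorem corootPairing_map (w : V ≃ₗᵢ[ℝ] V) (v u : V) :
    corootPairing (w v) (w u) = corootPairing v u := by
  simp [corootPairing]

theorem refl_self (v : V) : refl v v = -v := by
  by_cases hv : v = 0
  · simp [hv]
  · rw [refl_apply, corootPairing_self hv, two_smul]; abel

theorem refl_neg (v : V) : refl (-v) = refl v := by
  ext u; simp [refl_apply, corootPairing_neg]

theorem refl_refl (v u : V) : refl v (refl v u) = u := Submodule.reflection_reflection _ _

theorem refl_mul_self (v : V) : refl v * refl v = 1 := by
  ext u; exact refl_refl v u

theorem refl_inv (v : V) : (refl v)⁻¹ = refl v := inv_eq_of_mul_eq_one_right (refl_mul_self v)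

theorem refl_map (w : V ≃ₗᵢ[ℝ] V) (v : V) : refl (w v) = w * refl v * w⁻¹ := by
  rw [eq_mul_inv_iff_mul_eq]
  ext u
  change refl (w v) (w u) = w (refl v u)
  simp [refl_apply, corootPairing_map]

theorem mul_refl_eq (w : V ≃ₗᵢ[ℝ] V) (v : V) : w * refl v = refl (w v) * w := by
  rw [refl_map]; group

theorem inner_map_left (w : V ≃ₗᵢ[ℝ] V) (u y : V) : ⟪w u, y⟫_ℝ = ⟪u, w⁻¹ y⟫_ℝ := by
  rw [← w.inner_map_map u]
  congr 1
  exact (w.apply_symm_apply y).symm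

theorem inv_apply_self (w : V ≃ₗᵢ[ℝ] V) (u : V) : w⁻¹ (w u) = u := w.symm_apply_apply u

theorem apply_inv_self (w : V ≃ₗᵢ[ℝ] V) (u : V) : w (w⁻¹ u) = u := w.apply_symm_apply u

theorem refl_eq_self {v u : V} (h : ⟪v, u⟫_ℝ = 0) : refl v u = u := by
  simp [refl_apply, corootPairing, h]

/-- The reflection in v sends u to -u and also to u minus a multiple of v, so 2u is a multiple of v.
-/
theorem mem_span_of_refl_eq {u v : V} (h : refl u = refl v) :
    u ∈ (ℝ ∙ v : Submodule ℝ V) := by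
  have h1 := refl_self u
  rw [h, refl_apply] at h1
  rw [Submodule.mem_span_singleton]
  refine ⟨corootPairing v u / 2, ?_⟩
  have : (corootPairing v u) • v = (2 : ℝ) • u := by
    rw [sub_eq_iff_eq_add] at h1
    calc corootPairing v u • v = u + (-u + corootPairing v u • v) := by abel
      _ = (2 : ℝ) • u := by rw [← h1, two_smul]
  rw [div_eq_inv_mul, mul_smul, this, smul_smul]; norm_num

end Reflections

/-! ### Chambers, positive roots and simple roots. -/

section Chambers

variable {V : Type*} [NormedAddCommGroup V] [InnerProductSpace ℝ V]
  {W : Subgroup (V ≃ₗᵢ[ℝ] V)} {Φ C : Set V} {x : V}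

/-- A finite reflection group with a root system, a chamber, and a point of the chamber. -/
structure ChamberData (W : Subgroup (V ≃ₗᵢ[ℝ] V)) (Φ C : Set V) (x : V) : Prop where
  group : IsFiniteReflectionGroup W
  roots : IsRootSystemOf W Φ
  chamber : C = connectedComponentIn (hyperplaneComplement Φ) x
  regular : x ∈ hyperplaneComplement Φ

namespace ChamberData

theorem mem (h : ChamberData W Φ C x) : x ∈ C := by
  rw [h.chamber]; exact mem_connectedComponentIn h.regular

theorem map_mem (h : ChamberData W Φ C x) {w : V ≃ₗᵢ[ℝ] V} (hw : w ∈ W) {α : V} (hα : α ∈ Φ) :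
    w α ∈ Φ := h.roots.stable w hw α hα

theorem neg_mem (h : ChamberData W Φ C x) {α : V} (hα : α ∈ Φ) : -α ∈ Φ := by
  rw [← refl_self]; exact h.map_mem (h.roots.refl_mem α hα) hα

theorem eq_or_eq_neg (h : ChamberData W Φ C x) {α γ : V} (hα : α ∈ Φ) (hγ : γ ∈ Φ)
    (hs : γ ∈ (ℝ ∙ α : Submodule ℝ V)) : γ = α ∨ γ = -α := by
  obtain ⟨β, hβ⟩ := h.roots.pair α (h.roots.ne_zero α hα) (h.roots.refl_mem α hα)
  have h1 : α ∈ ({β, -β} : Set V) := hβ ▸ ⟨hα, Submodule.mem_span_singleton_self α⟩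
  have h2 : γ ∈ ({β, -β} : Set V) := hβ ▸ ⟨hγ, hs⟩
  rcases h1 with rfl | h1 <;> rcases h2 with rfl | h2
  · exact .inl rfl
  · exact .inr h2
  · right; rw [h1, neg_neg]
  · left; rw [h1, h2]

theorem eq_or_eq_neg_of_refl_eq (h : ChamberData W Φ C x) {α γ : V} (hα : α ∈ Φ) (hγ : γ ∈ Φ)
    (hs : refl γ = refl α) : γ = α ∨ γ = -α :=
  h.eq_or_eq_neg hα hγ (mem_span_of_refl_eq hs)

/-- Roots map to reflections in the finite group W, and each fibre is contained in a pair {α, -α}.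
-/
theorem finite_roots (h : ChamberData W Φ C x) : Φ.Finite := by
  have hfin : (W : Set (V ≃ₗᵢ[ℝ] V)).Finite := by
    have := h.group.finite; exact Set.toFinite _
  refine Set.Finite.of_finite_fibers refl (hfin.subset ?_) ?_
  · rintro _ ⟨α, hα, rfl⟩; exact h.roots.refl_mem α hα
  · rintro _ ⟨α, hα, rfl⟩
    refine (Set.toFinite {α, -α}).subset ?_
    rintro γ ⟨hγ, hs⟩
    exact h.eq_or_eq_neg_of_refl_eq hα hγ hs

/-- The chamber is connected and misses the hyperplane of α, so by the intermediate value theorem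
the sign at x persists on all of C. -/
theorem inner_pos_of_mem (h : ChamberData W Φ C x) {α v : V} (hα : α ∈ Φ) (hv : v ∈ C)
    (hx : 0 < ⟪α, x⟫_ℝ) : 0 < ⟪α, v⟫_ℝ := by
  by_contra hneg
  have hpc : IsPreconnected C := by rw [h.chamber]; exact isPreconnected_connectedComponentIn
  have hc : ContinuousOn (fun v : V => ⟪α, v⟫_ℝ) C := by fun_prop
  obtain ⟨y, hy, hy0⟩ := hpc.intermediate_value hv h.mem hc ⟨not_lt.1 hneg, hx.le⟩
  rw [h.chamber] at hy
  exact connectedComponentIn_subset _ _ hy α hα hy0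

theorem mem_positiveRoots (h : ChamberData W Φ C x) {α : V} :
    α ∈ positiveRoots Φ C ↔ α ∈ Φ ∧ 0 < ⟪α, x⟫_ℝ :=
  ⟨fun hα => ⟨hα.1, hα.2 x h.mem⟩, fun hα => ⟨hα.1, fun _ hv => h.inner_pos_of_mem hα.1 hv hα.2⟩⟩

theorem neg_mem_positiveRoots (h : ChamberData W Φ C x) {α : V} (hα : α ∈ Φ) :
    -α ∈ positiveRoots Φ C ↔ ⟪α, x⟫_ℝ < 0 := by
  rw [h.mem_positiveRoots, inner_neg_left, neg_pos]
  exact ⟨fun h => h.2, fun h' => ⟨h.neg_mem hα, h'⟩⟩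

theorem not_mem_positiveRoots (h : ChamberData W Φ C x) {α : V} (hα : α ∈ Φ) :
    α ∉ positiveRoots Φ C ↔ -α ∈ positiveRoots Φ C := by
  rw [h.neg_mem_positiveRoots hα, h.mem_positiveRoots]
  have := h.regular α hα
  exact ⟨fun h1 => lt_of_le_of_ne (not_lt.1 fun h2 => h1 ⟨hα, h2⟩) this,
    fun h1 h2 => absurd h1 (not_lt.2 h2.2.le)⟩

/-- The region cut out by the inequalities is convex, hence a connected subset of the complement
containing x. -/
theorem mem_iff (h : ChamberData W Φ C x) {v : V} :
    v ∈ C ↔ ∀ α ∈ positiveRoots Φ C, 0 < ⟪α, v⟫_ℝ := by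
  refine ⟨fun hv α hα => hα.2 v hv, fun hv => ?_⟩
  have hconv : Convex ℝ {v : V | ∀ α ∈ positiveRoots Φ C, 0 < ⟪α, v⟫_ℝ} := by
    intro y hy z hz a c ha hc hac α hα
    rw [inner_add_right, inner_smul_right, inner_smul_right]
    have h1 := hy α hα
    have h2 := hz α hα
    rcases ha.eq_or_lt with rfl | ha
    · obtain rfl : c = 1 := by linarith
      simpa using h2
    · exact add_pos_of_pos_of_nonneg (mul_pos ha h1) (mul_nonneg hc h2.le)
  rw [h.chamber]
  refine hconv.isPreconnected.subset_connectedComponentIn (x := x) ?_ ?_ hv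
  · exact fun α hα => (h.mem_positiveRoots.1 hα).2
  · intro y hy α hα
    by_cases hp : α ∈ positiveRoots Φ C
    · exact (hy α hp).ne'
    · have := hy _ ((h.not_mem_positiveRoots hα).1 hp)
      rw [inner_neg_left] at this
      linarith

theorem mem_closure_iff (h : ChamberData W Φ C x) {v : V} :
    v ∈ closure C ↔ ∀ α ∈ positiveRoots Φ C, 0 ≤ ⟪α, v⟫_ℝ := by
  constructor
  · intro hv α hα
    have hcl : IsClosed {v : V | 0 ≤ ⟪α, v⟫_ℝ} :=
      isClosed_le continuous_const (by fun_prop)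
    exact closure_minimal (fun y hy => (hα.2 y hy).le) hcl hv
  · intro hv
    have ht : Filter.Tendsto (fun t : ℝ => v + t • x) (nhdsWithin 0 (Set.Ioi 0)) (nhds v) := by
      have : Continuous fun t : ℝ => v + t • x := by fun_prop
      have := this.tendsto 0
      simp only [zero_smul, add_zero] at this
      exact this.mono_left nhdsWithin_le_nhds
    refine mem_closure_of_tendsto ht ?_
    filter_upwards [self_mem_nhdsWithin] with t ht
    refine h.mem_iff.2 fun α hα => ?_
    rw [inner_add_right, inner_smul_right]
    exact add_pos_of_nonneg_of_pos (hv α hα) (mul_pos ht (h.mem_positiveRoots.1 hα).2)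

theorem refl_simple_mem (h : ChamberData W Φ C x) {α : V} (hα : α ∈ simpleRoots Φ C) :
    refl α ∈ W := h.roots.refl_mem α hα.1.1

/-- A simple reflection permutes the positive roots other than its own root. -/
theorem refl_mem_positiveRoots (h : ChamberData W Φ C x) {α β : V} (hα : α ∈ simpleRoots Φ C)
    (hβ : β ∈ positiveRoots Φ C) (hne : β ≠ α) : refl α β ∈ positiveRoots Φ C := by
  by_contra hn
  have hγΦ : refl α β ∈ Φ := h.map_mem (h.refl_simple_mem hα) hβ.1
  have hγ := (h.not_mem_positiveRoots hγΦ).1 hn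
  set c := corootPairing α β with hc
  -- If the image of β were negative, α would be a positive multiple of a sum of two other positive
  -- roots, contradicting simplicity.
  have hsum : c • α = β + -(refl α β) := by rw [refl_apply]; abel
  have hαx := (h.mem_positiveRoots.1 hα.1).2
  have hβx := (h.mem_positiveRoots.1 hβ).2
  have hγx := (h.mem_positiveRoots.1 hγ).2
  have hcpos : 0 < c := by
    have : ⟪c • α, x⟫_ℝ = ⟪β + -(refl α β), x⟫_ℝ := by rw [hsum]
    rw [inner_add_left, inner_smul_left] at this
    have h2 : 0 < c * ⟪α, x⟫_ℝ := by
      have h3 : c * ⟪α, x⟫_ℝ = ⟪β, x⟫_ℝ + ⟪-(refl α) β, x⟫_ℝ := this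
      rw [h3]; positivity
    exact pos_of_mul_pos_left h2 hαx.le
  have hγne : -(refl α β) ≠ α := by
    intro he
    apply hne
    have : refl α (refl α β) = refl α (-α) :=
      congrArg _ (neg_eq_iff_eq_neg.1 he)
    rwa [refl_refl, map_neg, refl_self, neg_neg] at this
  apply hα.2
  have hα' : α = (⟨c⁻¹, (inv_pos.2 hcpos).le⟩ : NNReal) • (β + -(refl α β)) := by
    rw [← hsum]
    change α = c⁻¹ • c • α
    rw [smul_smul, inv_mul_cancel₀ hcpos.ne', one_smul]
  have hmem : (⟨c⁻¹, (inv_pos.2 hcpos).le⟩ : NNReal) • (β + -(refl α β)) ∈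
      Submodule.span NNReal (positiveRoots Φ C \ {α}) :=
    Submodule.smul_mem _ _ (Submodule.add_mem _ (Submodule.subset_span ⟨hβ, hne⟩)
      (Submodule.subset_span ⟨hγ, hγne⟩))
  rwa [← hα'] at hmem

/-- A vector that is negative on some positive root is negative on some simple root. -/
theorem exists_simple_inner_neg (h : ChamberData W Φ C x) {v β : V}
    (hβ : β ∈ positiveRoots Φ C) (hv : ⟪β, v⟫_ℝ < 0) :
    ∃ α ∈ simpleRoots Φ C, ⟪α, v⟫_ℝ < 0 := by
  have hfin : (positiveRoots Φ C).Finite := h.finite_roots.subset fun α hα => hα.1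
  -- Rescale the positive roots to the affine hyperplane ⟪·, x⟫ = 1. Minimise the functional v there
  -- and, among the minimisers, take the one of largest norm: this is an extreme point, hence a
  -- simple root.
  let key : V → ℝ ×ₗ ℝ := fun γ =>
    toLex (⟪γ, v⟫_ℝ / ⟪γ, x⟫_ℝ, -(⟪γ, γ⟫_ℝ / ⟪γ, x⟫_ℝ ^ 2))
  obtain ⟨γ, hγ, hmin⟩ := Set.exists_min_image _ key hfin ⟨β, hβ⟩
  have hpx : ∀ δ ∈ positiveRoots Φ C, 0 < ⟪δ, x⟫_ℝ := fun δ hδ => (h.mem_positiveRoots.1 hδ).2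
  have hγx := hpx γ hγ
  set m := ⟪γ, v⟫_ℝ / ⟪γ, x⟫_ℝ with hm
  have hm1 : ∀ δ ∈ positiveRoots Φ C, m ≤ ⟪δ, v⟫_ℝ / ⟪δ, x⟫_ℝ := by
    intro δ hδ
    rcases Prod.Lex.le_iff.1 (hmin δ hδ) with h1 | h1
    · exact h1.le
    · exact h1.1.le
  have hm0 : m < 0 := (hm1 β hβ).trans_lt (div_neg_of_neg_of_pos hv (hpx β hβ))
  have hγv : ⟪γ, v⟫_ℝ = m * ⟪γ, x⟫_ℝ := by rw [hm]; field_simp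
  refine ⟨γ, ⟨hγ, fun hspan => ?_⟩, by rw [hγv]; exact mul_neg_of_neg_of_pos hm0 hγx⟩
  -- A and B vanish at γ, while (A, B) is lexicographically positive on every other positive root
  -- and hence on nonzero points of their cone. For A = 0 this is strict Cauchy–Schwarz, since δ is
  -- not proportional to γ.
  let A : V → ℝ := fun z => ⟪z, v⟫_ℝ - m * ⟪z, x⟫_ℝ
  let B : V → ℝ := fun z => ⟪γ, γ⟫_ℝ * ⟪z, x⟫_ℝ - ⟪γ, x⟫_ℝ * ⟪z, γ⟫_ℝ
  have hcone : ∀ z ∈ Submodule.span NNReal (positiveRoots Φ C \ {γ}),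
      z = 0 ∨ 0 < A z ∨ (A z = 0 ∧ 0 < B z) := by
    intro z hz
    induction hz using Submodule.span_induction with
    | mem δ hδ =>
      right
      have hδx := hpx δ hδ.1
      have hle : m * ⟪δ, x⟫_ℝ ≤ ⟪δ, v⟫_ℝ := (le_div_iff₀ hδx).1 (hm1 δ hδ.1)
      rcases hle.eq_or_lt with heq | hlt
      · right
        refine ⟨by simp only [A]; linarith, ?_⟩
        have hmδ : m = ⟪δ, v⟫_ℝ / ⟪δ, x⟫_ℝ := by rw [eq_div_iff hδx.ne']; exact heq
        have h2 : ⟪δ, δ⟫_ℝ / ⟪δ, x⟫_ℝ ^ 2 ≤ ⟪γ, γ⟫_ℝ / ⟪γ, x⟫_ℝ ^ 2 := by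
          rcases Prod.Lex.le_iff.1 (hmin δ hδ.1) with h1 | h1
          · exact absurd h1 (by simp only [key, ofLex_toLex]; rw [← hmδ]; exact lt_irrefl _)
          · exact neg_le_neg_iff.1 h1.2
        rw [div_le_div_iff₀ (by positivity) (by positivity)] at h2
        have hne : ⟪γ, x⟫_ℝ • δ - ⟪δ, x⟫_ℝ • γ ≠ 0 := by
          intro h0
          rw [sub_eq_zero] at h0
          have hsp : δ ∈ (ℝ ∙ γ : Submodule ℝ V) := by
            rw [Submodule.mem_span_singleton]
            refine ⟨(⟪γ, x⟫_ℝ)⁻¹ * ⟪δ, x⟫_ℝ, ?_⟩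
            rw [mul_smul, ← h0, smul_smul, inv_mul_cancel₀ hγx.ne', one_smul]
          rcases h.eq_or_eq_neg hγ.1 hδ.1.1 hsp with h3 | h3
          · exact hδ.2 h3
          · rw [h3, inner_neg_left] at hδx; linarith
        have h4 := real_inner_self_pos.2 hne
        simp only [inner_sub_left, inner_sub_right, inner_smul_left, inner_smul_right,
          RCLike.conj_to_real] at h4
        rw [real_inner_comm δ γ] at h4
        change 0 < ⟪γ, γ⟫_ℝ * ⟪δ, x⟫_ℝ - ⟪γ, x⟫_ℝ * ⟪δ, γ⟫_ℝ
        have h5 : 0 < ⟪δ, x⟫_ℝ * (⟪γ, γ⟫_ℝ * ⟪δ, x⟫_ℝ - ⟪γ, x⟫_ℝ * ⟪δ, γ⟫_ℝ) := by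
          nlinarith
        exact pos_of_mul_pos_right h5 hδx.le
      · left; simp only [A]; linarith
    | zero => exact .inl rfl
    | add y z _ _ hy hz =>
      have hA : A (y + z) = A y + A z := by simp only [A, inner_add_left]; ring
      have hB : B (y + z) = B y + B z := by simp only [B, inner_add_left]; ring
      rcases hy with rfl | hy
      · simpa using hz
      rcases hz with rfl | hz
      · simpa using Or.inr hy
      right
      rw [hA, hB]
      rcases hy with hy | ⟨hy, hy'⟩ <;> rcases hz with hz | ⟨hz, hz'⟩
      · left; linarith
      · left; linarith
      · left; linarith
      · right; constructor <;> linarith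
    | smul a y _ hy =>
      have hA : A (a • y) = a * A y := by
        simp only [A, NNReal.smul_def, inner_smul_left, RCLike.conj_to_real]; ring
      have hB : B (a • y) = a * B y := by
        simp only [B, NNReal.smul_def, inner_smul_left, RCLike.conj_to_real]; ring
      rcases eq_or_ne a 0 with rfl | ha
      · left; simp
      have ha' : (0 : ℝ) < a := NNReal.coe_pos.2 (pos_iff_ne_zero.2 ha)
      rw [hA, hB]
      rcases hy with rfl | hy | ⟨hy, hy'⟩
      · left; simp
      · right; left; positivity
      · right; right; exact ⟨by rw [hy, mul_zero], by positivity⟩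
  rcases hcone γ hspan with h0 | h0 | ⟨-, h0⟩
  · exact h.roots.ne_zero γ hγ.1 h0
  · simp only [A, hγv, sub_self, lt_irrefl] at h0
  · simp only [B] at h0; linarith [mul_comm ⟪γ, γ⟫_ℝ ⟪γ, x⟫_ℝ]

end ChamberData

end Chambers

/-! ### Words in simple reflections, length, exchange and dominant vectors. -/

section Words

variable {V : Type*} [NormedAddCommGroup V] [InnerProductSpace ℝ V]
  {W : Subgroup (V ≃ₗᵢ[ℝ] V)} {Φ C : Set V} {x : V}

/-- The product of the reflections in the vectors of a list. -/
noncomputable def reflProd (l : List V) : V ≃ₗᵢ[ℝ] V := (l.map refl).prod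

theorem reflProd_nil : reflProd ([] : List V) = 1 := rfl

theorem reflProd_cons (α : V) (l : List V) : reflProd (α :: l) = refl α * reflProd l := rfl

theorem reflProd_append (l m : List V) : reflProd (l ++ m) = reflProd l * reflProd m := by
  simp [reflProd]

theorem wordLength_reflProd_le {l : List V} (hl : ∀ α ∈ l, α ∈ simpleRoots Φ C) :
    wordLength (simpleReflections Φ C) (reflProd l) ≤ l.length := by
  refine Nat.sInf_le ⟨l.map refl, by simp, fun s hs => ?_, rfl⟩
  obtain ⟨α, hα, rfl⟩ := List.mem_map.1 hs
  exact ⟨α, hl α hα, rfl⟩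

namespace ChamberData

theorem pos_or_neg (h : ChamberData W Φ C x) {α : V} (hα : α ∈ Φ) :
    α ∈ positiveRoots Φ C ∨ -α ∈ positiveRoots Φ C := by
  by_cases hp : α ∈ positiveRoots Φ C
  · exact .inl hp
  · exact .inr ((h.not_mem_positiveRoots hα).1 hp)

/-- Descent on the height ⟪γ, x⟫: a simple reflection lowers a positive root having positive product
with the simple root, and keeps it positive unless it is that simple root. Reflections in the two
roots are conjugate. -/
theorem refl_mem_closure (h : ChamberData W Φ C x) {β : V} (hβ : β ∈ positiveRoots Φ C) :
    refl β ∈ Subgroup.closure (simpleReflections Φ C) := by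
  by_contra hn
  have hfin : {γ ∈ positiveRoots Φ C | refl γ ∉ Subgroup.closure (simpleReflections Φ C)}.Finite :=
    h.finite_roots.subset fun α hα => hα.1.1
  obtain ⟨γ, ⟨hγ, hγn⟩, hmin⟩ := Set.exists_min_image _ (fun γ => ⟪γ, x⟫_ℝ) hfin ⟨β, hβ, hn⟩
  -- The vector -γ is negative on γ, so some simple α has positive product with γ.
  have hγγ : ⟪γ, -γ⟫_ℝ < 0 := by
    rw [inner_neg_right, neg_lt_zero]
    exact real_inner_self_pos.2 (h.roots.ne_zero γ hγ.1)
  obtain ⟨α, hα, hαγ⟩ := h.exists_simple_inner_neg hγ hγγ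
  rw [inner_neg_right, neg_lt_zero] at hαγ
  have hαW : refl α ∈ Subgroup.closure (simpleReflections Φ C) :=
    Subgroup.subset_closure ⟨α, hα, rfl⟩
  have hne : γ ≠ α := by rintro rfl; exact hγn hαW
  have hpos := h.refl_mem_positiveRoots hα hγ hne
  have hlt : ⟪refl α γ, x⟫_ℝ < ⟪γ, x⟫_ℝ := by
    rw [refl_apply, inner_sub_left, inner_smul_left, RCLike.conj_to_real]
    have h1 : 0 < corootPairing α γ :=
      div_pos (by positivity) (real_inner_self_pos.2 (h.roots.ne_zero α hα.1.1))
    have h2 := (h.mem_positiveRoots.1 hα.1).2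
    have := mul_pos h1 h2
    linarith
  have hmem : refl (refl α γ) ∈ Subgroup.closure (simpleReflections Φ C) := by
    by_contra hc
    exact absurd (hmin _ ⟨hpos, hc⟩) (not_le.2 hlt)
  apply hγn
  rw [← refl_refl α γ, refl_map]
  exact Subgroup.mul_mem _ (Subgroup.mul_mem _ hαW hmem) (Subgroup.inv_mem _ hαW)

theorem closure_simpleReflections (h : ChamberData W Φ C x) :
    Subgroup.closure (simpleReflections Φ C) = W := by
  apply le_antisymm
  · rw [Subgroup.closure_le]
    rintro _ ⟨α, hα, rfl⟩
    exact h.refl_simple_mem hα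
  · conv_lhs => rw [← h.group.generated]
    rw [Subgroup.closure_le]
    rintro _ ⟨hr, v, hv, rfl⟩
    obtain ⟨β, hβ⟩ := h.roots.pair v hv hr
    have hβm : β ∈ Φ ∩ (ℝ ∙ v : Submodule ℝ V) := hβ ▸ Set.mem_insert _ _
    obtain ⟨c, hc⟩ := Submodule.mem_span_singleton.1 hβm.2
    have hc0 : c ≠ 0 := by
      rintro rfl
      exact h.roots.ne_zero β hβm.1 (by rw [← hc, zero_smul])
    have hrefl : refl v = refl β := by
      ext u
      rw [refl_apply, refl_apply, ← hc]
      have hvv : ⟪v, v⟫_ℝ ≠ 0 := inner_self_ne_zero.2 hv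
      simp only [corootPairing, inner_smul_left, inner_smul_right, smul_smul, RCLike.conj_to_real]
      congr 2
      field_simp
    rw [SetLike.mem_coe, hrefl]
    rcases h.pos_or_neg hβm.1 with hp | hp
    · exact h.refl_mem_closure hp
    · rw [← refl_neg]; exact h.refl_mem_closure hp

theorem reflProd_mem (h : ChamberData W Φ C x) {l : List V}
    (hl : ∀ α ∈ l, α ∈ simpleRoots Φ C) : reflProd l ∈ W := by
  refine Subgroup.list_prod_mem _ fun s hs => ?_
  obtain ⟨α, hα, rfl⟩ := List.mem_map.1 hs
  exact h.refl_simple_mem (hl α hα)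

theorem exists_reduced_word (h : ChamberData W Φ C x) {w : V ≃ₗᵢ[ℝ] V} (hw : w ∈ W) :
    ∃ l : List V, (∀ α ∈ l, α ∈ simpleRoots Φ C) ∧
      l.length = wordLength (simpleReflections Φ C) w ∧ reflProd l = w := by
  have hne : {n | ∃ l : List (V ≃ₗᵢ[ℝ] V), l.length = n ∧
      (∀ s ∈ l, s ∈ simpleReflections Φ C) ∧ l.prod = w}.Nonempty := by
    rw [← h.closure_simpleReflections, ← Subgroup.mem_toSubmonoid,
      Subgroup.closure_toSubmonoid] at hw
    obtain ⟨l, hl, hlw⟩ := Submonoid.exists_list_of_mem_closure hw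
    refine ⟨l.length, l, rfl, fun s hs => ?_, hlw⟩
    rcases hl s hs with h1 | ⟨α, hα, h1⟩
    · exact h1
    · refine ⟨α, hα, ?_⟩
      rw [← refl_inv, h1, inv_inv]
  obtain ⟨l, hlen, hl, hlw⟩ := Nat.sInf_mem hne
  have hlift : ∀ l : List (V ≃ₗᵢ[ℝ] V), (∀ s ∈ l, s ∈ simpleReflections Φ C) →
      ∃ m : List V, (∀ α ∈ m, α ∈ simpleRoots Φ C) ∧ m.map refl = l := by
    intro l
    induction l with
    | nil => exact fun _ => ⟨[], by simp, rfl⟩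
    | cons s l ih =>
      intro hl
      obtain ⟨m, hm, rfl⟩ := ih fun t ht => hl t (List.mem_cons_of_mem _ ht)
      obtain ⟨α, hα, rfl⟩ := hl s List.mem_cons_self
      exact ⟨α :: m, by simpa using ⟨hα, hm⟩, rfl⟩
  obtain ⟨m, hm, rfl⟩ := hlift l hl
  exact ⟨m, hm, by rw [← List.length_map (f := refl)]; exact hlen, hlw⟩

/-- The strong exchange property. -/
theorem exists_word_mul_refl (h : ChamberData W Φ C x) {γ : V} (hγ : γ ∈ positiveRoots Φ C)
    {l : List V} (hl : ∀ α ∈ l, α ∈ simpleRoots Φ C)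
    (hneg : reflProd l γ ∉ positiveRoots Φ C) :
    ∃ m : List V, (∀ α ∈ m, α ∈ simpleRoots Φ C) ∧ m.length + 1 = l.length ∧
      reflProd m = reflProd l * refl γ := by
  induction l with
  | nil => exact absurd hγ hneg
  | cons α l ih =>
    have hl' : ∀ α ∈ l, α ∈ simpleRoots Φ C := fun β hβ => hl β (List.mem_cons_of_mem _ hβ)
    have hα : α ∈ simpleRoots Φ C := hl α List.mem_cons_self
    by_cases hp : reflProd l γ ∈ positiveRoots Φ C
    · have he : reflProd l γ = α := by
        by_contra hne
        exact hneg (h.refl_mem_positiveRoots hα hp hne)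
      refine ⟨l, hl', rfl, ?_⟩
      rw [reflProd_cons, mul_assoc, mul_refl_eq, he, ← mul_assoc, refl_mul_self, one_mul]
    · obtain ⟨m, hm, hlen, hprod⟩ := ih hl' hp
      exact ⟨α :: m, by simpa using ⟨hα, hm⟩, by simpa using hlen,
        by rw [reflProd_cons, reflProd_cons, hprod, mul_assoc]⟩

theorem wordLength_mul_refl_lt (h : ChamberData W Φ C x) {γ : V} (hγ : γ ∈ positiveRoots Φ C)
    {w : V ≃ₗᵢ[ℝ] V} (hw : w ∈ W) (hneg : w γ ∉ positiveRoots Φ C) :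
    wordLength (simpleReflections Φ C) (w * refl γ) < wordLength (simpleReflections Φ C) w := by
  obtain ⟨l, hl, hlen, rfl⟩ := h.exists_reduced_word hw
  obtain ⟨m, hm, hmlen, hprod⟩ := h.exists_word_mul_refl hγ hl hneg
  rw [← hprod, ← hlen]
  exact (wordLength_reflProd_le hm).trans_lt (by omega)

theorem lt_wordLength_mul_refl (h : ChamberData W Φ C x) {γ : V} (hγ : γ ∈ positiveRoots Φ C)
    {w : V ≃ₗᵢ[ℝ] V} (hw : w ∈ W) (hpos : w γ ∈ positiveRoots Φ C) :
    wordLength (simpleReflections Φ C) w < wordLength (simpleReflections Φ C) (w * refl γ) := by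
  have h1 : w * refl γ ∈ W := W.mul_mem hw (h.roots.refl_mem γ hγ.1)
  have h2 : (w * refl γ) γ ∉ positiveRoots Φ C := by
    change w (refl γ γ) ∉ _
    rw [refl_self, map_neg, h.not_mem_positiveRoots (h.neg_mem (h.map_mem hw hγ.1)), neg_neg]
    exact hpos
  have := h.wordLength_mul_refl_lt hγ h1 h2
  rwa [mul_assoc, refl_mul_self, mul_one] at this

theorem wordLength_mul_le (h : ChamberData W Φ C x) {u v : V ≃ₗᵢ[ℝ] V} (hu : u ∈ W)
    (hv : v ∈ W) : wordLength (simpleReflections Φ C) (u * v) ≤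
      wordLength (simpleReflections Φ C) u + wordLength (simpleReflections Φ C) v := by
  obtain ⟨l, hl, hlen, rfl⟩ := h.exists_reduced_word hu
  obtain ⟨m, hm, hmlen, rfl⟩ := h.exists_reduced_word hv
  rw [← hlen, ← hmlen, ← reflProd_append, ← List.length_append]
  exact wordLength_reflProd_le fun α hα => (List.mem_append.1 hα).elim (hl α) (hm α)

theorem wordLength_refl_le {α : V} (hα : α ∈ simpleRoots Φ C) :
    wordLength (simpleReflections Φ C) (refl α) ≤ 1 := by
  have := wordLength_reflProd_le (l := [α]) (Φ := Φ) (C := C) (by simpa using hα)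
  simpa [reflProd] using this

theorem wordLength_mul_simple (h : ChamberData W Φ C x) {α : V} (hα : α ∈ simpleRoots Φ C)
    {w : V ≃ₗᵢ[ℝ] V} (hw : w ∈ W) (hpos : w α ∈ positiveRoots Φ C) :
    wordLength (simpleReflections Φ C) (w * refl α) =
      wordLength (simpleReflections Φ C) w + 1 := by
  have h1 := h.lt_wordLength_mul_refl hα.1 hw hpos
  have h2 := h.wordLength_mul_le hw (h.refl_simple_mem hα)
  have h3 := wordLength_refl_le hα
  omega

theorem wordLength_mul_simple_of_neg (h : ChamberData W Φ C x) {α : V}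
    (hα : α ∈ simpleRoots Φ C) {w : V ≃ₗᵢ[ℝ] V} (hw : w ∈ W) (hneg : w α ∉ positiveRoots Φ C) :
    wordLength (simpleReflections Φ C) w =
      wordLength (simpleReflections Φ C) (w * refl α) + 1 := by
  have h1 := h.wordLength_mul_refl_lt hα.1 hw hneg
  have h2 := h.wordLength_mul_le (W.mul_mem hw (h.refl_simple_mem hα)) (h.refl_simple_mem hα)
  rw [mul_assoc, refl_mul_self, mul_one] at h2
  have h3 := wordLength_refl_le hα
  omega

/-- Otherwise every simple reflection would lengthen w on the right, whereas the last letter of a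
reduced word shortens it. -/
theorem exists_simple_neg (h : ChamberData W Φ C x) {w : V ≃ₗᵢ[ℝ] V} (hw : w ∈ W)
    (hne : w ≠ 1) : ∃ α ∈ simpleRoots Φ C, w α ∉ positiveRoots Φ C := by
  by_contra hcon
  push Not at hcon
  obtain ⟨l, hl, hlen, hprod⟩ := h.exists_reduced_word hw
  rcases List.eq_nil_or_concat l with rfl | ⟨m, α, rfl⟩
  · exact hne hprod.symm
  · rw [List.concat_eq_append] at *
    have hα : α ∈ simpleRoots Φ C := hl α (by simp)
    have hm : ∀ β ∈ m, β ∈ simpleRoots Φ C := fun β hβ => hl β (by simp [hβ])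
    have h1 := h.wordLength_mul_simple hα hw (hcon α hα)
    have h2 : w * refl α = reflProd m := by
      rw [← hprod, reflProd_append, mul_assoc]
      simp [reflProd, refl_mul_self]
    rw [h2] at h1
    have h3 := wordLength_reflProd_le hm
    simp at hlen
    omega

theorem wordLength_one : wordLength (simpleReflections Φ C) (1 : V ≃ₗᵢ[ℝ] V) = 0 :=
  Nat.le_zero.1 (wordLength_reflProd_le (l := []) (Φ := Φ) (C := C) (by simp))

theorem inner_nonneg_of_dominant (h : ChamberData W Φ C x) {ξ α : V} (hξ : ξ ∈ closure C)
    (hα : α ∈ positiveRoots Φ C) : 0 ≤ ⟪α, ξ⟫_ℝ := h.mem_closure_iff.1 hξ α hα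

/-- If `w` moves a dominant vector to a dominant vector, then a simple root that `w` makes
negative is orthogonal to it. -/
theorem inner_eq_zero_of_map_dominant (h : ChamberData W Φ C x) {ξ α : V} {w : V ≃ₗᵢ[ℝ] V}
    (hw : w ∈ W) (hξ : ξ ∈ closure C) (hwξ : w ξ ∈ closure C) (hα : α ∈ positiveRoots Φ C)
    (hneg : w α ∉ positiveRoots Φ C) : ⟪α, ξ⟫_ℝ = 0 := by
  apply le_antisymm _ (h.inner_nonneg_of_dominant hξ hα)
  have := h.inner_nonneg_of_dominant hwξ ((h.not_mem_positiveRoots (h.map_mem hw hα.1)).1 hneg)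
  rw [inner_neg_left, w.inner_map_map] at this
  linarith

/-- Induction on a length bound: a simple root made negative by w is orthogonal to ξ, so its
reflection fixes ξ and can be stripped off w. This gives both the uniqueness of the dominant element
and the generators of its isotropy group. -/
theorem dominant_unique (h : ChamberData W Φ C x) {ξ : V} (hξ : ξ ∈ closure C)
    (n : ℕ) {w : V ≃ₗᵢ[ℝ] V} (hw : w ∈ W) (hwξ : w ξ ∈ closure C)
    (hn : wordLength (simpleReflections Φ C) w ≤ n) :
    w ξ = ξ ∧ w ∈ Subgroup.closure (refl '' {α ∈ simpleRoots Φ C | ⟪α, ξ⟫_ℝ = 0}) := by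
  induction n generalizing w with
  | zero =>
    obtain ⟨l, hl, hlen, rfl⟩ := h.exists_reduced_word hw
    obtain rfl : l = [] := List.eq_nil_of_length_eq_zero (by omega)
    exact ⟨rfl, Subgroup.one_mem _⟩
  | succ n ih =>
    by_cases h1 : w = 1
    · subst h1; exact ⟨rfl, Subgroup.one_mem _⟩
    obtain ⟨α, hα, hneg⟩ := h.exists_simple_neg hw h1
    have h0 := h.inner_eq_zero_of_map_dominant hw hξ hwξ hα.1 hneg
    have hfix := refl_eq_self h0
    have hlen := h.wordLength_mul_simple_of_neg hα hw hneg
    have hmap : (w * refl α) ξ = w ξ := congrArg w hfix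
    obtain ⟨h2, h3⟩ := ih (W.mul_mem hw (h.refl_simple_mem hα)) (hmap ▸ hwξ) (by omega)
    refine ⟨hmap ▸ h2, ?_⟩
    have : w = w * refl α * refl α := by rw [mul_assoc, refl_mul_self, mul_one]
    rw [this]
    exact Subgroup.mul_mem _ h3 (Subgroup.subset_closure ⟨α, ⟨hα, h0⟩, rfl⟩)

theorem isotropy_eq_closure (h : ChamberData W Φ C x) {ξ : V} (hξ : ξ ∈ closure C) :
    isotropy W ξ = Subgroup.closure (refl '' {α ∈ simpleRoots Φ C | ⟪α, ξ⟫_ℝ = 0}) := by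
  apply le_antisymm
  · rintro w ⟨hw, hwξ⟩
    have hfix : w ξ = ξ := hwξ
    exact (h.dominant_unique hξ _ hw (by rwa [hfix]) le_rfl).2
  · rw [Subgroup.closure_le]
    rintro _ ⟨α, ⟨hα, h0⟩, rfl⟩
    exact ⟨h.refl_simple_mem hα, refl_eq_self h0⟩

theorem eq_one_of_map_mem (h : ChamberData W Φ C x) {w : V ≃ₗᵢ[ℝ] V} (hw : w ∈ W)
    (hx : w x = x) : w = 1 := by
  by_contra hne
  obtain ⟨α, hα, hneg⟩ := h.exists_simple_neg hw hne
  have hxC := subset_closure h.mem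
  have := h.inner_eq_zero_of_map_dominant hw hxC (by rwa [hx]) hα.1 hneg
  exact h.regular α hα.1.1 this

theorem exists_dominant (h : ChamberData W Φ C x) (v : V) :
    ∃ w ∈ W, w v ∈ closure C := by
  have := h.group.finite
  -- The orbit point with the largest product with x is dominant: reflecting in a positive root on
  -- which it is negative would increase that product.
  obtain ⟨⟨w, hw⟩, hmax⟩ := Finite.exists_max fun w : W => ⟪(w : V ≃ₗᵢ[ℝ] V) v, x⟫_ℝ
  refine ⟨w, hw, h.mem_closure_iff.2 fun α hα => ?_⟩
  by_contra hneg
  have h1 := hmax ⟨refl α * w, W.mul_mem (h.roots.refl_mem α hα.1) hw⟩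
  change ⟪refl α (w v), x⟫_ℝ ≤ ⟪w v, x⟫_ℝ at h1
  rw [refl_apply, inner_sub_left, inner_smul_left, RCLike.conj_to_real] at h1
  have h2 : corootPairing α (w v) < 0 :=
    div_neg_of_neg_of_pos (by linarith) (real_inner_self_pos.2 (h.roots.ne_zero α hα.1))
  have := mul_neg_of_neg_of_pos h2 (h.mem_positiveRoots.1 hα).2
  linarith

/-- Lengths add along the factorization of `W` by the isotropy group of a dominant vector. -/
theorem wordLength_mul_of_minimal (h : ChamberData W Φ C x) {ξ : V} (hξ : ξ ∈ closure C)
    {w : V ≃ₗᵢ[ℝ] V} (hw : w ∈ W)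
    (hmin : ∀ v ∈ isotropy W ξ, wordLength (simpleReflections Φ C) w ≤
      wordLength (simpleReflections Φ C) (w * v)) (n : ℕ)
    {v : V ≃ₗᵢ[ℝ] V} (hv : v ∈ isotropy W ξ)
    (hn : wordLength (simpleReflections Φ C) v ≤ n) :
    wordLength (simpleReflections Φ C) (w * v) =
      wordLength (simpleReflections Φ C) w + wordLength (simpleReflections Φ C) v := by
  induction n generalizing v with
  | zero =>
    obtain ⟨l, hl, hlen, rfl⟩ := h.exists_reduced_word hv.1
    obtain rfl : l = [] := List.eq_nil_of_length_eq_zero (by omega)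
    rw [reflProd_nil, mul_one, wordLength_one, add_zero]
  | succ n ih =>
    by_cases h1 : v = 1
    · subst h1; rw [mul_one, wordLength_one, add_zero]
    have hvξ : v ξ = ξ := hv.2
    obtain ⟨α, hα, hneg⟩ := h.exists_simple_neg hv.1 h1
    have h0 := h.inner_eq_zero_of_map_dominant hv.1 hξ (by rwa [hvξ]) hα.1 hneg
    have hlen := h.wordLength_mul_simple_of_neg hα hv.1 hneg
    have hs : refl α ∈ isotropy W ξ := ⟨h.refl_simple_mem hα, refl_eq_self h0⟩
    have hvs := (isotropy W ξ).mul_mem hv hs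
    have hih := ih hvs (by omega)
    have hpos : (v * refl α) α ∈ positiveRoots Φ C := by
      change v (refl α α) ∈ _
      rw [refl_self, map_neg]
      exact (h.not_mem_positiveRoots (h.map_mem hv.1 hα.1.1)).1 hneg
    have hort : ⟪(v * refl α) α, ξ⟫_ℝ = 0 := by
      have : (v * refl α) ξ = ξ := hvs.2
      rw [← this, (v * refl α).inner_map_map, h0]
    -- This root is positive and orthogonal to ξ, so its reflection lies in the isotropy group; were
    -- w to make it negative, that reflection would shorten w, contrary to minimality.
    have hwpos : w ((v * refl α) α) ∈ positiveRoots Φ C := by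
      by_contra hc
      have h2 := hmin (refl ((v * refl α) α)) ⟨h.roots.refl_mem _ hpos.1, refl_eq_self hort⟩
      have h3 := h.wordLength_mul_refl_lt hpos hw hc
      omega
    have h4 := h.wordLength_mul_simple hα (W.mul_mem hw hvs.1) hwpos
    rw [mul_assoc, mul_assoc, refl_mul_self, mul_one] at h4
    rw [h4, hih]
    omega

end ChamberData

end Words

/-! ### Divided differences and their independence of the word. -/

section DividedDifferences

open MvPolynomial

theorem homogeneousComponent_mul_of_left {σ R : Type*} [CommSemiring R]
    {p : MvPolynomial σ R} {m : ℕ} (hp : p.IsHomogeneous m)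
    (n : ℕ) (q : MvPolynomial σ R) :
    homogeneousComponent (m + n) (p * q) = p * homogeneousComponent n q := by
  let _ := MvPolynomial.gradedAlgebra (σ := σ) (R := R)
  have := DirectSum.coe_decompose_mul_add_of_left_mem (homogeneousSubmodule σ R) (j := n)
    (b := q) (show p ∈ homogeneousSubmodule σ R m from hp)
  rwa [← decomposition.decompose'_apply, ← decomposition.decompose'_apply]

theorem homogeneousComponent_mul_of_lt {σ R : Type*} [CommSemiring R]
    {p : MvPolynomial σ R} {m : ℕ} (hp : p.IsHomogeneous m)
    {n : ℕ} (hn : n < m) (q : MvPolynomial σ R) : homogeneousComponent n (p * q) = 0 := by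
  let _ := MvPolynomial.gradedAlgebra (σ := σ) (R := R)
  have := DirectSum.coe_decompose_mul_of_left_mem_of_not_le (homogeneousSubmodule σ R) (b := q)
    (show p ∈ homogeneousSubmodule σ R m from hp) (not_le.2 hn)
  rwa [← decomposition.decompose'_apply]

variable {V : Type*} [NormedAddCommGroup V] [InnerProductSpace ℝ V]
  {ι : Type*} [Fintype ι] (b : Module.Basis ι ℝ V)

/-- The linear form `⟪u, ·⟫` as a polynomial. -/
noncomputable def linearForm (u : V) : MvPolynomial ι ℂ := ∑ i, C ((⟪u, b i⟫_ℝ : ℝ) : ℂ) * X i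

theorem linearForm_sub (u v : V) : linearForm b (u - v) = linearForm b u - linearForm b v := by
  simp [linearForm, inner_sub_left, sub_mul]

theorem linearForm_smul (c : ℝ) (u : V) : linearForm b (c • u) = C (c : ℂ) * linearForm b u := by
  simp [linearForm, inner_smul_left, Finset.mul_sum, mul_assoc]

theorem polyAct_linearForm (w : V ≃ₗᵢ[ℝ] V) (u : V) :
    polyAct b w (linearForm b u) = linearForm b (w u) := by
  have key : ∀ j, ⟪w u, b j⟫_ℝ = ∑ i, ⟪u, b i⟫_ℝ * b.repr (w⁻¹ (b j)) i := by
    intro j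
    rw [inner_map_left]
    conv_lhs => rw [← b.sum_repr (w⁻¹ (b j)), inner_sum]
    exact Finset.sum_congr rfl fun i _ => by rw [inner_smul_right, mul_comm]
  simp only [linearForm, map_sum, map_mul, polyAct, aeval_X, algHom_C, algebraMap_eq,
    key, Complex.ofReal_sum, Complex.ofReal_mul, Finset.mul_sum, Finset.sum_mul]
  rw [Finset.sum_comm]
  simp only [mul_assoc]

/-- By Riesz every coordinate is an inner product with a vector, so inductions over polynomials need
only multiplication by linear forms, on which isometries act transparently. -/
theorem exists_linearForm_eq_X (i : ι) : ∃ u, linearForm b u = X i := by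
  classical
  have : FiniteDimensional ℝ V := Module.Finite.of_basis b
  have : CompleteSpace V := FiniteDimensional.complete ℝ V
  refine ⟨(InnerProductSpace.toDual ℝ V).symm (LinearMap.toContinuousLinearMap (b.coord i)), ?_⟩
  simp [linearForm, Finsupp.single_apply, apply_ite]

/-- Evaluation of polynomials at a point of `V`. -/
noncomputable def evalAt (v : V) : MvPolynomial ι ℂ →ₐ[ℂ] ℂ := aeval fun i => ((b.repr v i : ℝ) : ℂ)

theorem evalAt_polyAct (w : V ≃ₗᵢ[ℝ] V) (v : V) (f : MvPolynomial ι ℂ) :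
    evalAt b v (polyAct b w f) = evalAt b (w⁻¹ v) f := by
  suffices (evalAt b v).comp (polyAct b w) = evalAt b (w⁻¹ v) from DFunLike.congr_fun this f
  ext i
  have key : b.repr (w⁻¹ v) i = ∑ j, b.repr (w⁻¹ (b j)) i * b.repr v j := by
    conv_lhs => rw [← b.sum_repr v, map_sum, map_sum, Finsupp.finsetSum_apply]
    exact Finset.sum_congr rfl fun j _ => by
      rw [map_smul, map_smul, Finsupp.smul_apply, smul_eq_mul, mul_comm]
  simp only [evalAt, polyAct, AlgHom.comp_apply, aeval_X, map_sum, map_mul, algHom_C, key,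
    Complex.ofReal_sum, Complex.ofReal_mul, Algebra.algebraMap_self, RingHom.id_apply]

theorem evalAt_linearForm (u v : V) : evalAt b v (linearForm b u) = ((⟪u, v⟫_ℝ : ℝ) : ℂ) := by
  conv_rhs => rw [← b.sum_repr v, inner_sum]
  simp [evalAt, linearForm, inner_smul_right, mul_comm]

theorem linearForm_ne_zero {α : V} (hα : α ≠ 0) : linearForm b α ≠ 0 := by
  intro h
  have := evalAt_linearForm b α α
  rw [h, map_zero, eq_comm, Complex.ofReal_eq_zero] at this
  exact hα (inner_self_eq_zero.1 this)

theorem isHomogeneous_linearForm (u : V) : (linearForm b u).IsHomogeneous 1 :=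
  IsHomogeneous.sum _ _ _ fun i _ => isHomogeneous_C_mul_X _ i

theorem isHomogeneous_polyAct {f : MvPolynomial ι ℂ} {n : ℕ} (hf : f.IsHomogeneous n)
    (w : V ≃ₗᵢ[ℝ] V) : (polyAct b w f).IsHomogeneous n := by
  have := hf.aeval (n := 1) (fun i =>
    ∑ j, MvPolynomial.C ((b.repr (w⁻¹ (b j)) i : ℝ) : ℂ) * MvPolynomial.X j)
    fun i => IsHomogeneous.sum _ _ _ fun j _ => isHomogeneous_C_mul_X _ j
  rwa [one_mul] at this

theorem linearForm_sub_polyAct_refl (α u : V) :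
    linearForm b u - linearForm b (refl α u) =
      C ((corootPairing α u : ℝ) : ℂ) * linearForm b α := by
  rw [refl_apply, linearForm_sub, linearForm_smul]; ring

theorem linearForm_dvd_sub (α : V) (f : MvPolynomial ι ℂ) :
    linearForm b α ∣ f - polyAct b (refl α) f := by
  induction f using MvPolynomial.induction_on with
  | C a => simp [polyAct]
  | add p q hp hq =>
    rw [map_add, add_sub_add_comm]; exact dvd_add hp hq
  | mul_X p i hp =>
    obtain ⟨u, hu⟩ := exists_linearForm_eq_X b i
    rw [← hu, map_mul, polyAct_linearForm]
    have : p * linearForm b u - polyAct b (refl α) p * linearForm b (refl α u) =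
        (p - polyAct b (refl α) p) * linearForm b u +
          polyAct b (refl α) p * (linearForm b u - linearForm b (refl α u)) := by ring
    rw [this, linearForm_sub_polyAct_refl]
    exact dvd_add (hp.mul_right _) (Dvd.intro_left _ (mul_assoc _ _ _))

open Classical in
/-- The divided difference `(f - s_α f) / α`. -/
noncomputable def dividedDifference (α : V) : MvPolynomial ι ℂ →ₗ[ℂ] MvPolynomial ι ℂ :=
  if hα : α = 0 then 0 else
    { toFun := fun f => (linearForm_dvd_sub b α f).choose
      map_add' := fun f g => mul_left_cancel₀ (linearForm_ne_zero b hα) <| by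
        rw [mul_add, ← (linearForm_dvd_sub b α f).choose_spec,
          ← (linearForm_dvd_sub b α g).choose_spec,
          ← (linearForm_dvd_sub b α (f + g)).choose_spec, map_add]
        ring
      map_smul' := fun c f => mul_left_cancel₀ (linearForm_ne_zero b hα) <| by
        rw [RingHom.id_apply, mul_smul_comm, ← (linearForm_dvd_sub b α f).choose_spec,
          ← (linearForm_dvd_sub b α (c • f)).choose_spec, map_smul, smul_sub] }

theorem linearForm_mul_dividedDifference {α : V} (hα : α ≠ 0) (f : MvPolynomial ι ℂ) :
    linearForm b α * dividedDifference b α f = f - polyAct b (refl α) f := by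
  rw [dividedDifference, dif_neg hα]
  exact (linearForm_dvd_sub b α f).choose_spec.symm

theorem dividedDifference_eq {α : V} (hα : α ≠ 0) {f g : MvPolynomial ι ℂ}
    (h : linearForm b α * g = f - polyAct b (refl α) f) : dividedDifference b α f = g :=
  mul_left_cancel₀ (linearForm_ne_zero b hα) <| by
    rw [h, linearForm_mul_dividedDifference b hα]

theorem dividedDifference_of_invariant {α : V} (hα : α ≠ 0) {f : MvPolynomial ι ℂ}
    (h : polyAct b (refl α) f = f) : dividedDifference b α f = 0 :=
  dividedDifference_eq b hα (by rw [h, mul_zero, sub_self])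

theorem dividedDifference_invariant_mul {α : V} (hα : α ≠ 0) {r : MvPolynomial ι ℂ}
    (h : polyAct b (refl α) r = r) (f : MvPolynomial ι ℂ) :
    dividedDifference b α (r * f) = r * dividedDifference b α f :=
  dividedDifference_eq b hα <| by
    rw [mul_left_comm, linearForm_mul_dividedDifference b hα, map_mul, h, mul_sub]

/-- Twisted Leibniz rule; iterating it along a word produces one correction term for each deleted
letter. -/
theorem dividedDifference_linearForm_mul {α : V} (hα : α ≠ 0) (u : V) (f : MvPolynomial ι ℂ) :
    dividedDifference b α (linearForm b u * f) =
      linearForm b (refl α u) * dividedDifference b α f + ((corootPairing α u : ℝ) : ℂ) • f :=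
  dividedDifference_eq b hα <| by
    rw [mul_add, mul_left_comm, linearForm_mul_dividedDifference b hα, map_mul,
      polyAct_linearForm, smul_eq_C_mul]
    linear_combination f * -linearForm_sub_polyAct_refl b α u

theorem isHomogeneous_dividedDifference {α : V} (hα : α ≠ 0) {f : MvPolynomial ι ℂ} {n : ℕ}
    (hf : f.IsHomogeneous (n + 1)) : (dividedDifference b α f).IsHomogeneous n := by
  have h1 : (f - polyAct b (refl α) f).IsHomogeneous (n + 1) :=
    hf.sub (isHomogeneous_polyAct b hf _)
  rw [← linearForm_mul_dividedDifference b hα, add_comm] at h1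
  have h2 := homogeneousComponent_mul_of_left (isHomogeneous_linearForm b α) n
    (dividedDifference b α f)
  rw [homogeneousComponent_eq_self h1] at h2
  rw [mul_left_cancel₀ (linearForm_ne_zero b hα) h2]
  exact homogeneousComponent_isHomogeneous _ _

/-- The composite of the divided differences along a list of roots. -/
noncomputable def wordOperator (l : List V) : Module.End ℂ (MvPolynomial ι ℂ) :=
  (l.map (dividedDifference b)).prod

theorem wordOperator_nil : wordOperator b [] = 1 := rfl

theorem wordOperator_cons (α : V) (l : List V) (f : MvPolynomial ι ℂ) :
    wordOperator b (α :: l) f = dividedDifference b α (wordOperator b l f) := rfl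

theorem wordOperator_append (l m : List V) (f : MvPolynomial ι ℂ) :
    wordOperator b (l ++ m) f = wordOperator b l (wordOperator b m f) := by
  simp [wordOperator]

theorem wordOperator_one {l : List V} (hl : ∀ α ∈ l, α ≠ 0) (hne : l ≠ []) :
    wordOperator b l 1 = 0 := by
  induction l with
  | nil => exact absurd rfl hne
  | cons α l ih =>
    rw [wordOperator_cons]
    rcases eq_or_ne l [] with rfl | hl'
    · exact dividedDifference_of_invariant b (hl α List.mem_cons_self) (map_one _)
    · rw [ih (fun β hβ => hl β (List.mem_cons_of_mem _ hβ)) hl', map_zero]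

theorem wordOperator_invariant_mul {l : List V} (hl : ∀ α ∈ l, α ≠ 0) {r : MvPolynomial ι ℂ}
    (hr : ∀ α ∈ l, polyAct b (refl α) r = r) (f : MvPolynomial ι ℂ) :
    wordOperator b l (r * f) = r * wordOperator b l f := by
  induction l with
  | nil => rfl
  | cons α l ih =>
    rw [wordOperator_cons, ih (fun β hβ => hl β (List.mem_cons_of_mem _ hβ))
      (fun β hβ => hr β (List.mem_cons_of_mem _ hβ)), dividedDifference_invariant_mul b
      (hl α List.mem_cons_self) (hr α List.mem_cons_self), wordOperator_cons]

variable {M : Type*} [AddCommGroup M] [Module ℂ M]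

/-- The sum over all ways to delete a letter from a word, weighted by the pairing of `u` with
the coroot attached to the deleted letter. -/
noncomputable def deletionSum (u : V) : List V → (List V → M) → M
  | [], _ => 0
  | α :: l, G => ((corootPairing α (reflProd l u) : ℝ) : ℂ) • G l +
      deletionSum u l fun m => G (α :: m)

theorem map_deletionSum (φ : M →ₗ[ℂ] M) (u : V) (l : List V) (G : List V → M) :
    φ (deletionSum u l G) = deletionSum u l fun m => φ (G m) := by
  induction l generalizing G with
  | nil => exact map_zero φ
  | cons α l ih => rw [deletionSum, deletionSum, map_add, map_smul, ih]

theorem deletionSum_congr (u : V) {l : List V} {G G' : List V → M}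
    (hG : ∀ m : List V, (∀ α ∈ m, α ∈ l) → m.length + 1 = l.length → G m = G' m) :
    deletionSum u l G = deletionSum u l G' := by
  induction l generalizing G G' with
  | nil => rfl
  | cons α l ih =>
    rw [deletionSum, deletionSum, hG l (fun β hβ => List.mem_cons_of_mem _ hβ) rfl]
    congr 1
    refine ih fun m hm hlen => hG _ ?_ (by simp [hlen])
    intro β hβ
    rcases List.mem_cons.1 hβ with rfl | hβ
    · exact List.mem_cons_self
    · exact List.mem_cons_of_mem _ (hm β hβ)

theorem wordOperator_linearForm_mul {l : List V} (hl : ∀ α ∈ l, α ≠ 0) (u : V)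
    (f : MvPolynomial ι ℂ) :
    wordOperator b l (linearForm b u * f) = linearForm b (reflProd l u) * wordOperator b l f +
      deletionSum u l fun m => wordOperator b m f := by
  induction l with
  | nil => exact (add_zero _).symm
  | cons α l ih =>
    rw [wordOperator_cons, ih fun β hβ => hl β (List.mem_cons_of_mem _ hβ), map_add,
      dividedDifference_linearForm_mul b (hl α List.mem_cons_self), map_deletionSum, deletionSum,
      add_assoc]
    rfl

variable {W : Subgroup (V ≃ₗᵢ[ℝ] V)} {Φ C : Set V} {x : V}

open Classical in
/-- The indicator function of the positive roots. -/
noncomputable def positiveIndicator (Φ C : Set V) (γ : V) : ℂ :=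
  if γ ∈ positiveRoots Φ C then 1 else 0

namespace ChamberData

/-- The sum over the inversions `γ` of `w` of the values `F (w s_γ)`, weighted by the pairing
of `u` with the coroot of `γ`, written as a sum over all roots. -/
noncomputable def inversionSum (h : ChamberData W Φ C x) (w : V ≃ₗᵢ[ℝ] V) (u : V)
    (F : (V ≃ₗᵢ[ℝ] V) → M) : M :=
  ∑ γ ∈ h.finite_roots.toFinset,
    -- The roots γ and -γ contribute equally, since the indicator difference and the pairing both
    -- change sign; the factor 1/2 corrects the double count.
    ((1 / 2 : ℂ) * (positiveIndicator Φ C γ - positiveIndicator Φ C (w γ)) *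
      ((corootPairing γ u : ℝ) : ℂ)) • F (w * refl γ)

theorem positiveIndicator_neg (h : ChamberData W Φ C x) {γ : V} (hγ : γ ∈ Φ) :
    positiveIndicator Φ C (-γ) = 1 - positiveIndicator Φ C γ := by
  have := h.not_mem_positiveRoots hγ
  by_cases hp : γ ∈ positiveRoots Φ C
  · have h2 : -γ ∉ positiveRoots Φ C := fun h2 => this.2 h2 hp
    simp [positiveIndicator, hp, h2]
  · simp [positiveIndicator, hp, this.1 hp]

theorem positiveIndicator_sub (h : ChamberData W Φ C x) {α γ : V}
    (hα : α ∈ simpleRoots Φ C) (hγ : γ ∈ Φ) (h1 : γ ≠ α) (h2 : γ ≠ -α) :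
    positiveIndicator Φ C γ - positiveIndicator Φ C (refl α γ) = 0 := by
  rcases h.pos_or_neg hγ with hp | hp
  · simp [positiveIndicator, hp, h.refl_mem_positiveRoots hα hp h1]
  · have h3 := h.refl_mem_positiveRoots hα hp fun h3 => h2 (neg_eq_iff_eq_neg.1 h3)
    rw [map_neg] at h3
    have h4 : ∀ δ ∈ Φ, -δ ∈ positiveRoots Φ C → positiveIndicator Φ C δ = 0 := by
      intro δ hδ hn
      simp [positiveIndicator, (h.not_mem_positiveRoots hδ).2 hn]
    rw [h4 γ hγ hp, h4 _ (h.map_mem (h.refl_simple_mem hα) hγ) h3, sub_zero]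

/-- Insert the indicator of w γ to telescope the difference. The new part is supported on w γ = ±α,
where s_α w s_γ = w, so it collapses to a single term. -/
theorem inversionSum_cons (h : ChamberData W Φ C x) {α : V} (hα : α ∈ simpleRoots Φ C)
    {w : V ≃ₗᵢ[ℝ] V} (hw : w ∈ W) (u : V) (F : (V ≃ₗᵢ[ℝ] V) → M) :
    h.inversionSum (refl α * w) u F =
      ((corootPairing α (w u) : ℝ) : ℂ) • F w +
        h.inversionSum w u fun v => F (refl α * v) := by
  classical
  have hsplit : h.inversionSum (refl α * w) u F =
      (∑ γ ∈ h.finite_roots.toFinset,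
        ((1 / 2 : ℂ) * (positiveIndicator Φ C (w γ) - positiveIndicator Φ C (refl α (w γ))) *
          ((corootPairing γ u : ℝ) : ℂ)) • F (refl α * w * refl γ)) +
      h.inversionSum w u fun v => F (refl α * v) := by
    rw [inversionSum, inversionSum, ← Finset.sum_add_distrib]
    refine Finset.sum_congr rfl fun γ _ => ?_
    rw [← mul_assoc, ← add_smul]
    congr 1
    change _ * (_ - positiveIndicator Φ C (refl α (w γ))) * _ = _
    ring
  rw [hsplit]
  congr 1
  set δ := w⁻¹ α with hδ
  have hwδ : w δ = α := apply_inv_self w α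
  have hα0 := h.roots.ne_zero α hα.1.1
  have hδΦ : δ ∈ Φ := h.map_mem (W.inv_mem hw) hα.1.1
  have hδ0 := h.roots.ne_zero δ hδΦ
  have hne : δ ≠ -δ := fun h0 => by
    have : (2 : ℝ) • δ = 0 := by rw [two_smul]; nth_rewrite 1 [h0]; abel
    exact hδ0 ((smul_eq_zero.1 this).resolve_left two_ne_zero)
  have hsub : ({δ, -δ} : Finset V) ⊆ h.finite_roots.toFinset := by
    intro γ hγ
    rw [Set.Finite.mem_toFinset]
    rcases Finset.mem_insert.1 hγ with rfl | hγ
    · exact hδΦ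
    · rw [Finset.mem_singleton.1 hγ]; exact h.neg_mem hδΦ
  rw [← Finset.sum_subset hsub, Finset.sum_pair hne]
  · have hprod : refl α * w * refl δ = w := by
      rw [mul_assoc, mul_refl_eq, hwδ, ← mul_assoc, refl_mul_self, one_mul]
    have hpair : corootPairing δ u = corootPairing α (w u) := by
      rw [← hwδ, corootPairing_map]
    have hαpos : positiveIndicator Φ C α = 1 := by simp [positiveIndicator, hα.1]
    rw [refl_neg, hprod, map_neg, map_neg, hwδ, refl_self, neg_neg, corootPairing_neg, hpair,
      h.positiveIndicator_neg hα.1.1, hαpos, ← add_smul]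
    congr 1
    push_cast
    ring
  · intro γ hγ hγn
    rw [Set.Finite.mem_toFinset] at hγ
    rw [h.positiveIndicator_sub hα (h.map_mem hw hγ), mul_zero, zero_mul, zero_smul]
    · intro h1
      exact hγn (by rw [Finset.mem_insert]; left; rw [hδ, ← h1, inv_apply_self])
    · intro h1
      refine hγn (Finset.mem_insert_of_mem (Finset.mem_singleton.2 ?_))
      rw [hδ, ← map_neg, ← h1, inv_apply_self]

/-- The left side is defined through the letters of the word, the right side only through its
product. This makes the correction terms agree for two words of the same element, with no braid
relations. -/
theorem deletionSum_eq_inversionSum (h : ChamberData W Φ C x) {l : List V}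
    (hl : ∀ α ∈ l, α ∈ simpleRoots Φ C) (u : V) (F : (V ≃ₗᵢ[ℝ] V) → M) :
    (deletionSum u l fun m => F (reflProd m)) = h.inversionSum (reflProd l) u F := by
  induction l generalizing F with
  | nil =>
    rw [deletionSum, inversionSum, Finset.sum_eq_zero]
    intro γ _
    change (_ * (_ - positiveIndicator Φ C γ) * _) • _ = _
    rw [sub_self, mul_zero, zero_mul, zero_smul]
  | cons α l ih =>
    have hl' : ∀ α ∈ l, α ∈ simpleRoots Φ C := fun β hβ => hl β (List.mem_cons_of_mem _ hβ)
    rw [deletionSum, reflProd_cons, h.inversionSum_cons (hl α List.mem_cons_self)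
      (h.reflProd_mem hl'), ← ih hl']
    rfl

theorem inversionSum_eq_zero (h : ChamberData W Φ C x) {w : V ≃ₗᵢ[ℝ] V} (hw : w ∈ W) (u : V)
    {F : (V ≃ₗᵢ[ℝ] V) → M} (hF : ∀ v, wordLength (simpleReflections Φ C) v <
      wordLength (simpleReflections Φ C) w → F v = 0) : h.inversionSum w u F = 0 := by
  refine Finset.sum_eq_zero fun γ hγ => ?_
  rw [Set.Finite.mem_toFinset] at hγ
  by_cases hp : γ ∈ positiveRoots Φ C
  · by_cases hq : w γ ∈ positiveRoots Φ C
    · simp [positiveIndicator, hp, hq]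
    · rw [hF _ (h.wordLength_mul_refl_lt hp hw hq), smul_zero]
  · by_cases hq : w γ ∈ positiveRoots Φ C
    · have hp' := (h.not_mem_positiveRoots hγ).1 hp
      have hq' : w (-γ) ∉ positiveRoots Φ C := by
        rw [map_neg, h.not_mem_positiveRoots (h.neg_mem (h.map_mem hw hγ)), neg_neg]
        exact hq
      rw [← refl_neg, hF _ (h.wordLength_mul_refl_lt hp' hw hq'), smul_zero]
    · simp [positiveIndicator, hp, hq]

end ChamberData

/-- Linear forms generate the algebra, so an operator that commutes with them up to a twist is
determined by its value at 1. -/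
theorem eq_zero_of_linearForm_mul {D : Module.End ℂ (MvPolynomial ι ℂ)} (w : V ≃ₗᵢ[ℝ] V)
    (h1 : D 1 = 0) (hD : ∀ u f, D (linearForm b u * f) = linearForm b (w u) * D f) : D = 0 := by
  refine LinearMap.ext fun f => ?_
  rw [LinearMap.zero_apply]
  induction f using MvPolynomial.induction_on with
  | C a => rw [C_eq_smul_one, map_smul, h1, smul_zero]
  | add p q hp hq => rw [map_add, hp, hq, add_zero]
  | mul_X p i hp =>
    obtain ⟨u, hu⟩ := exists_linearForm_eq_X b i
    rw [← hu, mul_comm, hD, hp, mul_zero]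

namespace ChamberData

/-- Divided differences along words of length `k` depend only on the product of the word, and
vanish if the word is not reduced. -/
theorem exists_operator (h : ChamberData W Φ C x) (k : ℕ) :
    ∃ F : (V ≃ₗᵢ[ℝ] V) → Module.End ℂ (MvPolynomial ι ℂ),
      (∀ w, wordLength (simpleReflections Φ C) w ≠ k → F w = 0) ∧
      ∀ l : List V, (∀ α ∈ l, α ∈ simpleRoots Φ C) → l.length = k →
        wordOperator b l = F (reflProd l) := by
  classical
  have hne0 : ∀ {l : List V}, (∀ α ∈ l, α ∈ simpleRoots Φ C) → ∀ α ∈ l, α ≠ 0 :=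
    fun hl α hα => h.roots.ne_zero α (hl α hα).1.1
  induction k with
  | zero =>
    refine ⟨fun w => if wordLength (simpleReflections Φ C) w = 0 then 1 else 0,
      fun w hw => if_neg hw, fun l _ hl => ?_⟩
    obtain rfl := List.eq_nil_of_length_eq_zero hl
    beta_reduce
    rw [reflProd_nil, wordLength_one, if_pos rfl, wordOperator_nil]
  | succ k ih =>
    obtain ⟨F, hF0, hF⟩ := ih
    have hcomm : ∀ l : List V, (∀ α ∈ l, α ∈ simpleRoots Φ C) → l.length = k + 1 →
        ∀ u f, wordOperator b l (linearForm b u * f) =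
          linearForm b (reflProd l u) * wordOperator b l f +
            h.inversionSum (reflProd l) u fun w => F w f := by
      intro l hl hlen u f
      rw [wordOperator_linearForm_mul b (hne0 hl), ← h.deletionSum_eq_inversionSum hl]
      congr 1
      refine deletionSum_congr u fun m hm hmlen => ?_
      rw [hF m (fun α hα => hl α (hm α hα)) (by omega)]
    have hone : ∀ l : List V, (∀ α ∈ l, α ∈ simpleRoots Φ C) → l.length = k + 1 →
        wordOperator b l 1 = 0 := by
      intro l hl hlen
      exact wordOperator_one b (hne0 hl) (by rintro rfl; simp at hlen)
    refine ⟨fun w => if hw : wordLength (simpleReflections Φ C) w = k + 1 ∧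
        ∃ l : List V, (∀ α ∈ l, α ∈ simpleRoots Φ C) ∧ l.length = k + 1 ∧ reflProd l = w
      then wordOperator b hw.2.choose else 0, fun w hw => dif_neg fun h' => hw h'.1,
      fun l hl hlen => ?_⟩
    beta_reduce
    by_cases hw : wordLength (simpleReflections Φ C) (reflProd l) = k + 1
    · have hex : wordLength (simpleReflections Φ C) (reflProd l) = k + 1 ∧ ∃ m : List V,
          (∀ α ∈ m, α ∈ simpleRoots Φ C) ∧ m.length = k + 1 ∧ reflProd m = reflProd l :=
        ⟨hw, l, hl, hlen, rfl⟩
      rw [dif_pos hex]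
      obtain ⟨hm, hmlen, hprod⟩ := hex.2.choose_spec
      -- Two words with the same product have the same correction terms, so their difference
      -- satisfies the commutation rule without corrections and kills 1.
      rw [← sub_eq_zero]
      refine eq_zero_of_linearForm_mul b (reflProd l) ?_ fun u f => ?_
      · rw [LinearMap.sub_apply, hone l hl hlen, hone _ hm hmlen, sub_zero]
      · rw [LinearMap.sub_apply, LinearMap.sub_apply, hcomm l hl hlen, hcomm _ hm hmlen, hprod]
        ring
    · rw [dif_neg fun h' => hw h'.1]
      -- A non-reduced product has length at most k, so the corrections involve only elements of
      -- length below k, where F vanishes.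
      refine eq_zero_of_linearForm_mul b (reflProd l) (hone l hl hlen) fun u f => ?_
      rw [hcomm l hl hlen, h.inversionSum_eq_zero (h.reflProd_mem hl), add_zero]
      intro v hv
      have := wordLength_reflProd_le hl
      rw [hF0 v (by omega), LinearMap.zero_apply]

theorem wordOperator_congr (h : ChamberData W Φ C x) {l m : List V}
    (hl : ∀ α ∈ l, α ∈ simpleRoots Φ C) (hm : ∀ α ∈ m, α ∈ simpleRoots Φ C)
    (hlen : l.length = m.length) (hprod : reflProd l = reflProd m) :
    wordOperator b l = wordOperator b m := by
  obtain ⟨F, -, hF⟩ := h.exists_operator b m.length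
  rw [hF l hl hlen, hF m hm rfl, hprod]

theorem wordOperator_eq_zero (h : ChamberData W Φ C x) {l : List V}
    (hl : ∀ α ∈ l, α ∈ simpleRoots Φ C)
    (hlen : wordLength (simpleReflections Φ C) (reflProd l) ≠ l.length) :
    wordOperator b l = 0 := by
  obtain ⟨F, hF0, hF⟩ := h.exists_operator b l.length
  rw [hF l hl rfl, hF0 _ hlen]

end ChamberData

end DividedDifferences

/-! ### Averaging over finite groups, and interpolation. -/

section Averages

open MvPolynomial

variable {V : Type*} [NormedAddCommGroup V] [InnerProductSpace ℝ V]
  {ι : Type*} [Fintype ι] (b : Module.Basis ι ℝ V)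

/-- The average of a polynomial over a finite group of isometries. -/
noncomputable def average (H : Subgroup (V ≃ₗᵢ[ℝ] V)) [Fintype H] :
    MvPolynomial ι ℂ →ₗ[ℂ] MvPolynomial ι ℂ :=
  (Fintype.card H : ℂ)⁻¹ • ∑ w : H, (polyAct b (w : V ≃ₗᵢ[ℝ] V)).toLinearMap

variable (H : Subgroup (V ≃ₗᵢ[ℝ] V)) [Fintype H]

theorem average_apply (f : MvPolynomial ι ℂ) :
    average b H f = (Fintype.card H : ℂ)⁻¹ • ∑ w : H, polyAct b (w : V ≃ₗᵢ[ℝ] V) f := by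
  simp [average]

theorem card_inv_mul_card : (Fintype.card H : ℂ)⁻¹ * Fintype.card H = 1 :=
  inv_mul_cancel₀ (Nat.cast_ne_zero.2 Fintype.card_ne_zero)

theorem polyAct_average {w : V ≃ₗᵢ[ℝ] V} (hw : w ∈ H) (f : MvPolynomial ι ℂ) :
    polyAct b w (average b H f) = average b H f := by
  rw [average_apply, map_smul, map_sum]
  refine congrArg _ ?_
  have key : ∀ v : H, polyAct b w (polyAct b (v : V ≃ₗᵢ[ℝ] V) f) =
      (fun u : H => polyAct b (u : V ≃ₗᵢ[ℝ] V) f) (Equiv.mulLeft ⟨w, hw⟩ v) := fun v => by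
    rw [← AlgHom.comp_apply, ← polyAct_mul]; rfl
  rw [Finset.sum_congr rfl fun v _ => key v]
  exact Equiv.sum_comp (Equiv.mulLeft (⟨w, hw⟩ : H)) fun u : H => polyAct b (u : V ≃ₗᵢ[ℝ] V) f

theorem average_of_invariant {f : MvPolynomial ι ℂ} (hf : ∀ w ∈ H, polyAct b w f = f) :
    average b H f = f := by
  rw [average_apply, Finset.sum_congr rfl fun (w : H) _ => hf w w.2, Finset.sum_const,
    Finset.card_univ, ← Nat.cast_smul_eq_nsmul ℂ, smul_smul, card_inv_mul_card, one_smul]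

theorem average_invariant_mul {r : MvPolynomial ι ℂ} (hr : ∀ w ∈ H, polyAct b w r = r)
    (f : MvPolynomial ι ℂ) : average b H (r * f) = r * average b H f := by
  rw [average_apply, average_apply, mul_smul_comm, Finset.mul_sum]
  congr 1
  exact Finset.sum_congr rfl fun w _ => by rw [map_mul, hr w w.2]

theorem isHomogeneous_average {f : MvPolynomial ι ℂ} {n : ℕ} (hf : f.IsHomogeneous n) :
    (average b H f).IsHomogeneous n := by
  rw [average_apply, smul_eq_C_mul]
  exact (IsHomogeneous.sum _ _ _ fun w _ => isHomogeneous_polyAct b hf _).C_mul _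

theorem sub_average_mem {J : Ideal (MvPolynomial ι ℂ)} {f : MvPolynomial ι ℂ}
    (hf : ∀ w ∈ H, f - polyAct b w f ∈ J) : f - average b H f ∈ J := by
  have : f - average b H f =
      (Fintype.card H : ℂ)⁻¹ • ∑ w : H, (f - polyAct b (w : V ≃ₗᵢ[ℝ] V) f) := by
    rw [Finset.sum_sub_distrib, smul_sub, ← average_apply, Finset.sum_const, Finset.card_univ,
      ← Nat.cast_smul_eq_nsmul ℂ, smul_smul, card_inv_mul_card, one_smul]
  rw [this, smul_eq_C_mul]
  exact J.mul_mem_left _ (J.sum_mem fun w _ => hf w w.2)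

theorem evalAt_average (v : V) (f : MvPolynomial ι ℂ) :
    evalAt b v (average b H f) =
      (Fintype.card H : ℂ)⁻¹ * ∑ w : H, evalAt b ((w : V ≃ₗᵢ[ℝ] V)⁻¹ v) f := by
  rw [average_apply, map_smul, smul_eq_mul, map_sum]
  simp only [evalAt_polyAct]

theorem homogeneousComponent_polyAct (w : V ≃ₗᵢ[ℝ] V) (n : ℕ) (f : MvPolynomial ι ℂ) :
    homogeneousComponent n (polyAct b w f) = polyAct b w (homogeneousComponent n f) := by
  conv_lhs => rw [← sum_homogeneousComponent f, map_sum, map_sum]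
  rw [Finset.sum_congr rfl fun i _ => homogeneousComponent_of_mem (m := n)
    (isHomogeneous_polyAct b (homogeneousComponent_isHomogeneous i f) w), Finset.sum_ite_eq]
  split_ifs with hn
  · rfl
  · rw [homogeneousComponent_eq_zero n f (by simpa using hn), map_zero]

/-- Polynomials take arbitrary values on a finite set of points. -/
theorem exists_evalAt_eq (T : Finset V) (g : V → ℂ) :
    ∃ p : MvPolynomial ι ℂ, ∀ t ∈ T, evalAt b t p = g t := by
  classical
  -- Lagrange interpolation: the factor ⟪z - y, · - y⟫ / ⟪z - y, z - y⟫ is 1 at z and 0 at y.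
  let q : V → MvPolynomial ι ℂ := fun z => ∏ y ∈ T.erase z,
    C (((⟪z - y, z - y⟫_ℝ)⁻¹ : ℝ) : ℂ) * (linearForm b (z - y) - C ((⟪z - y, y⟫_ℝ : ℝ) : ℂ))
  have hq : ∀ z t, evalAt b t (q z) =
      ∏ y ∈ T.erase z, (((⟪z - y, z - y⟫_ℝ)⁻¹ * ⟪z - y, t - y⟫_ℝ : ℝ) : ℂ) := by
    intro z t
    simp only [q, map_prod, map_mul, map_sub, evalAt_linearForm]
    refine Finset.prod_congr rfl fun y _ => ?_
    have hC : ∀ c : ℂ, evalAt b t (C c) = c := fun c => by simp [evalAt]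
    rw [hC, hC, inner_sub_right (z - y) t y]
    push_cast
    ring
  refine ⟨∑ z ∈ T, C (g z) * q z, fun t ht => ?_⟩
  have hC : ∀ c : ℂ, evalAt b t (C c) = c := fun c => by simp [evalAt]
  rw [map_sum, Finset.sum_eq_single_of_mem t ht]
  · rw [map_mul, hC, hq, Finset.prod_eq_one, mul_one]
    intro y hy
    have : ⟪t - y, t - y⟫_ℝ ≠ 0 :=
      inner_self_ne_zero.2 (sub_ne_zero.2 (Finset.ne_of_mem_erase hy).symm)
    rw [inv_mul_cancel₀ this, Complex.ofReal_one]
  · intro z _ hzt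
    rw [map_mul, hq, Finset.prod_eq_zero (Finset.mem_erase.2 ⟨hzt.symm, ht⟩), mul_zero]
    simp

end Averages

/-! ### The ideal of invariants as seen by divided differences. -/

section InvariantIdeal

open MvPolynomial

variable {V : Type*} [NormedAddCommGroup V] [InnerProductSpace ℝ V]
  {ι : Type*} [Fintype ι] (b : Module.Basis ι ℝ V)
  {W : Subgroup (V ≃ₗᵢ[ℝ] V)} {Φ C : Set V} {x : V}

theorem polyAct_mem_invariantIdeal {w : V ≃ₗᵢ[ℝ] V} (hw : w ∈ W) {f : MvPolynomial ι ℂ}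
    (hf : f ∈ invariantIdeal b W) : polyAct b w f ∈ invariantIdeal b W :=
  invariantIdeal_le_comap b W ⟨w, hw⟩ hf

namespace ChamberData

/-- Invariants pass through divided differences, so for a generator r the result is a multiple of r,
which has no constant term. Quantifying over a multiplier g makes the span induction go through. -/
theorem constantCoeff_wordOperator (h : ChamberData W Φ C x) {l : List V}
    (hl : ∀ α ∈ l, α ∈ simpleRoots Φ C) {f : MvPolynomial ι ℂ} (hf : f ∈ invariantIdeal b W) :
    constantCoeff (wordOperator b l f) = 0 := by
  suffices ∀ g, constantCoeff (wordOperator b l (g * f)) = 0 by simpa using this 1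
  induction hf using Submodule.span_induction with
  | mem r hr =>
    intro g
    rw [mul_comm, wordOperator_invariant_mul b (fun α hα => h.roots.ne_zero α (hl α hα).1.1)
      (fun α hα => hr.1 _ (h.refl_simple_mem (hl α hα))), map_mul, hr.2, zero_mul]
  | zero => simp
  | add p q _ _ hp hq => intro g; rw [mul_add, map_add, map_add, hp, hq, add_zero]
  | smul a p _ hp => intro g; rw [smul_eq_mul, ← mul_assoc]; exact hp _

theorem sub_polyAct_mem (h : ChamberData W Φ C x) {f : MvPolynomial ι ℂ}
    (hf : ∀ α ∈ simpleRoots Φ C, f - polyAct b (refl α) f ∈ invariantIdeal b W)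
    {w : V ≃ₗᵢ[ℝ] V} (hw : w ∈ W) : f - polyAct b w f ∈ invariantIdeal b W := by
  obtain ⟨l, hl, -, rfl⟩ := h.exists_reduced_word hw
  clear hw
  induction l with
  | nil => simp [reflProd_nil, polyAct_one]
  | cons α l ih =>
    have hα := hl α List.mem_cons_self
    have h1 := ih fun β hβ => hl β (List.mem_cons_of_mem _ hβ)
    have h2 := polyAct_mem_invariantIdeal b (h.refl_simple_mem hα) h1
    have h3 := Ideal.add_mem _ (hf α hα) h2
    rwa [map_sub, sub_add_sub_cancel, ← AlgHom.comp_apply, ← polyAct_mul] at h3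

/-- A homogeneous polynomial lies in the ideal of the invariants as soon as all divided
differences of complementary order vanish. -/
theorem mem_invariantIdeal (h : ChamberData W Φ C x) {d : ℕ} {f : MvPolynomial ι ℂ}
    (hf : f.IsHomogeneous d)
    (hl : ∀ l : List V, (∀ α ∈ l, α ∈ simpleRoots Φ C) → l.length = d →
      constantCoeff (wordOperator b l f) = 0) : f ∈ invariantIdeal b W := by
  induction d generalizing f with
  | zero =>
    have h0 : constantCoeff f = 0 := hl [] (by simp) rfl
    rw [← homogeneousComponent_eq_self hf, homogeneousComponent_zero, ← constantCoeff_eq, h0,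
      C_0]
    exact Ideal.zero_mem _
  | succ d ih =>
    have := h.group.finite
    have := Fintype.ofFinite W
    have h1 : ∀ w ∈ W, f - polyAct b w f ∈ invariantIdeal b W := by
      intro w hw
      refine h.sub_polyAct_mem b (fun α hα => ?_) hw
      have hα0 := h.roots.ne_zero α hα.1.1
      -- f - s_α f is α times a divided difference of f, which lies in the ideal by induction on the
      -- degree.
      rw [← linearForm_mul_dividedDifference b hα0]
      refine Ideal.mul_mem_left _ _
        (ih (isHomogeneous_dividedDifference b hα0 hf) fun l hls hlen => ?_)
      have := hl (l ++ [α]) (fun β hβ => (List.mem_append.1 hβ).elim (hls β)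
        fun hβ => List.mem_singleton.1 hβ ▸ hα) (by simp [hlen])
      rwa [wordOperator_append] at this
    -- Modulo the ideal f agrees with its W-average, an invariant of positive degree and hence a
    -- generator.
    have h2 := sub_average_mem b W h1
    have h3 : average b W f ∈ invariantIdeal b W := by
      refine Ideal.subset_span ⟨fun w hw => polyAct_average b W hw f, ?_⟩
      rw [constantCoeff_eq]
      exact (isHomogeneous_average b W hf).coeff_eq_zero (by simp)
    simpa using Ideal.add_mem _ h2 h3

end ChamberData

end InvariantIdeal

/-! ### Minimal coset representatives. -/

section MinimalRepresentatives

variable {V : Type*} [NormedAddCommGroup V] [InnerProductSpace ℝ V]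
  {W : Subgroup (V ≃ₗᵢ[ℝ] V)} {Φ C : Set V} {x β : V} {ξ : MulAction.orbit W β}

/-- A choice, for every element `α` of an orbit, of a reduced word for an element of least length
among those sending `ξ` to `α`. -/
structure MinimalWords (Φ C : Set V) (ξ : MulAction.orbit W β)
    (word : MulAction.orbit W β → List V) : Prop where
  simple : ∀ α, ∀ γ ∈ word α, γ ∈ simpleRoots Φ C
  length_eq : ∀ α, (word α).length = minLength (simpleReflections Φ C) W (ξ : V) (α : V)
  map : ∀ α, reflProd (word α) ξ = α
  reduced : ∀ α, wordLength (simpleReflections Φ C) (reflProd (word α)) = (word α).length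

theorem minLength_le {w : V ≃ₗᵢ[ℝ] V} (hw : w ∈ W) (S : Set (V ≃ₗᵢ[ℝ] V)) (v : V) :
    minLength S W v (w v) ≤ wordLength S w :=
  Nat.sInf_le ⟨w, ⟨hw, rfl⟩, rfl⟩

theorem exists_mem_map_eq (ξ α : MulAction.orbit W β) :
    ∃ w ∈ W, w (ξ : V) = α := by
  obtain ⟨w, hw⟩ := MulAction.exists_smul_eq W ξ α
  exact ⟨w, w.2, congrArg Subtype.val hw⟩

theorem ChamberData.exists_minimalWords (h : ChamberData W Φ C x) (ξ : MulAction.orbit W β) :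
    ∃ word, MinimalWords Φ C ξ word := by
  have key : ∀ α : MulAction.orbit W β, ∃ l : List V, (∀ γ ∈ l, γ ∈ simpleRoots Φ C) ∧
      l.length = minLength (simpleReflections Φ C) W (ξ : V) (α : V) ∧ reflProd l ξ = α ∧
      wordLength (simpleReflections Φ C) (reflProd l) = l.length := by
    intro α
    have hne : (wordLength (simpleReflections Φ C) '' {w | w ∈ W ∧ w • (ξ : V) = α}).Nonempty := by
      obtain ⟨w, hw, hwξ⟩ := exists_mem_map_eq ξ α
      exact ⟨_, w, ⟨hw, hwξ⟩, rfl⟩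
    obtain ⟨w, ⟨hw, hwξ⟩, hlen⟩ := Nat.sInf_mem hne
    obtain ⟨l, hl, hllen, rfl⟩ := h.exists_reduced_word hw
    exact ⟨l, hl, hllen.trans hlen, hwξ, hllen.symm⟩
  choose word h1 h2 h3 h4 using key
  exact ⟨word, h1, h2, h3, h4⟩

namespace MinimalWords

variable {word : MulAction.orbit W β → List V}

theorem mem (hm : MinimalWords Φ C ξ word) (h : ChamberData W Φ C x)
    (α : MulAction.orbit W β) : reflProd (word α) ∈ W := h.reflProd_mem (hm.simple α)

theorem wordLength_mul (hm : MinimalWords Φ C ξ word) (h : ChamberData W Φ C x)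
    (hξ : (ξ : V) ∈ closure C) (α : MulAction.orbit W β) {v : V ≃ₗᵢ[ℝ] V}
    (hv : v ∈ isotropy W (ξ : V)) :
    wordLength (simpleReflections Φ C) (reflProd (word α) * v) =
      (word α).length + wordLength (simpleReflections Φ C) v := by
  rw [← hm.reduced]
  refine h.wordLength_mul_of_minimal hξ (hm.mem h α) (fun u hu => ?_) _ hv le_rfl
  have hu' : u ξ = ξ := hu.2
  have := minLength_le (W.mul_mem (hm.mem h α) hu.1) (simpleReflections Φ C) ξ
  change minLength _ _ _ (reflProd (word α) (u ξ)) ≤ _ at this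
  rwa [hu', hm.map, ← hm.length_eq, ← hm.reduced] at this

theorem exists_eq_mul (hm : MinimalWords Φ C ξ word) (h : ChamberData W Φ C x)
    {w : V ≃ₗᵢ[ℝ] V} (hw : w ∈ W) {α : MulAction.orbit W β} (hα : w ξ = α) :
    ∃ v ∈ isotropy W (ξ : V), w = reflProd (word α) * v := by
  refine ⟨(reflProd (word α))⁻¹ * w, ⟨W.mul_mem (W.inv_mem (hm.mem h α)) hw, ?_⟩, by group⟩
  change (reflProd (word α))⁻¹ (w ξ) = ξ
  rw [hα, ← hm.map α, inv_apply_self]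

theorem eq_of_wordLength_eq (hm : MinimalWords Φ C ξ word) (h : ChamberData W Φ C x)
    (hξ : (ξ : V) ∈ closure C) {w : V ≃ₗᵢ[ℝ] V} (hw : w ∈ W) {α : MulAction.orbit W β}
    (hα : w ξ = α) (hlen : wordLength (simpleReflections Φ C) w =
      minLength (simpleReflections Φ C) W (ξ : V) (α : V)) : w = reflProd (word α) := by
  obtain ⟨v, hv, rfl⟩ := hm.exists_eq_mul h hw hα
  rw [hm.wordLength_mul h hξ α hv, ← hm.length_eq] at hlen
  obtain ⟨l, -, hl, rfl⟩ := h.exists_reduced_word hv.1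
  obtain rfl : l = [] := List.eq_nil_of_length_eq_zero (by omega)
  rw [reflProd_nil, mul_one]

end MinimalWords

end MinimalRepresentatives

/-! ### Upper bound for the graded multiplicities. -/

section UpperBound

open MvPolynomial

variable {V : Type*} [NormedAddCommGroup V] [InnerProductSpace ℝ V]
  {ι : Type*} [Fintype ι] (b : Module.Basis ι ℝ V)
  {W : Subgroup (V ≃ₗᵢ[ℝ] V)} {Φ C : Set V} {x β : V} {ξ : MulAction.orbit W β}
  {word : MulAction.orbit W β → List V}

/-- Divided differences of an invariant of the isotropy group are detected on the minimal coset
representatives. -/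
theorem MinimalWords.constantCoeff_wordOperator_eq_zero (hm : MinimalWords Φ C ξ word)
    (h : ChamberData W Φ C x) (hξ : (ξ : V) ∈ closure C) {f : MvPolynomial ι ℂ}
    (hf : ∀ w ∈ isotropy W (ξ : V), polyAct b w f = f) {d : ℕ}
    (hd : ∀ α, (word α).length = d → constantCoeff (wordOperator b (word α) f) = 0)
    {l : List V} (hl : ∀ α ∈ l, α ∈ simpleRoots Φ C) (hlen : l.length = d) :
    constantCoeff (wordOperator b l f) = 0 := by
  by_cases hred : wordLength (simpleReflections Φ C) (reflProd l) = l.length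
  swap
  · rw [h.wordOperator_eq_zero b hl hred, LinearMap.zero_apply, map_zero]
  have hlW := h.reflProd_mem hl
  let α : MulAction.orbit W β := (⟨reflProd l, hlW⟩ : W) • ξ
  obtain ⟨v, hv, hlv⟩ := hm.exists_eq_mul h hlW (α := α) rfl
  have hlenv := hm.wordLength_mul h hξ α hv
  rw [← hlv] at hlenv
  by_cases hv1 : v = 1
  · subst hv1
    rw [mul_one] at hlv
    have hla : l.length = (word α).length := by rw [← hred, hlv, hm.reduced]
    rw [h.wordOperator_congr b hl (hm.simple α) hla hlv]
    exact hd α (by omega)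
  · have hvξ : v ξ = ξ := hv.2
    -- The nontrivial factor v has a right descent γ orthogonal to ξ. Lengths add, so γ is also a
    -- descent of the whole product, and the word may be rewritten to end in γ, whose divided
    -- difference kills f.
    obtain ⟨γ, hγ, hneg⟩ := h.exists_simple_neg hv.1 hv1
    have h0 := h.inner_eq_zero_of_map_dominant hv.1 hξ (by rwa [hvξ]) hγ.1 hneg
    have hs : refl γ ∈ isotropy W (ξ : V) := ⟨h.refl_simple_mem hγ, refl_eq_self h0⟩
    have hlenvs := hm.wordLength_mul h hξ α ((isotropy W (ξ : V)).mul_mem hv hs)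
    have hdrop := h.wordLength_mul_simple_of_neg hγ hv.1 hneg
    rw [← mul_assoc, ← hlv] at hlenvs
    obtain ⟨m, hms, hmlen, hmprod⟩ :=
      h.exists_reduced_word (W.mul_mem hlW (h.refl_simple_mem hγ))
    have hmγ : ∀ δ ∈ m ++ [γ], δ ∈ simpleRoots Φ C := fun δ hδ =>
      (List.mem_append.1 hδ).elim (hms δ) fun hδ => List.mem_singleton.1 hδ ▸ hγ
    have hprod : reflProd l = reflProd (m ++ [γ]) := by
      rw [reflProd_append, hmprod, mul_assoc]
      simp [reflProd, refl_mul_self]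
    rw [h.wordOperator_congr b hl hmγ (by simp; omega) hprod, wordOperator_append,
      wordOperator_cons, wordOperator_nil, Module.End.one_apply,
      dividedDifference_of_invariant b (h.roots.ne_zero γ hγ.1.1) (hf _ hs), map_zero, map_zero]

/-- The functional on the coinvariant algebra given by a word in the divided differences. -/
noncomputable def ChamberData.coinvariantFunctional (h : ChamberData W Φ C x) (l : List V)
    (hl : ∀ α ∈ l, α ∈ simpleRoots Φ C) : Coinvariant b W →ₗ[ℂ] ℂ :=
  ((invariantIdeal b W).restrictScalars ℂ).liftQ
      (lcoeff ℂ 0 ∘ₗ wordOperator b l)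
      (fun _ hf => h.constantCoeff_wordOperator b hl hf) ∘ₗ
    (Submodule.Quotient.restrictScalarsEquiv ℂ (invariantIdeal b W)).symm.toLinearMap

theorem ChamberData.coinvariantFunctional_mk (h : ChamberData W Φ C x) (l : List V)
    (hl : ∀ α ∈ l, α ∈ simpleRoots Φ C) (f : MvPolynomial ι ℂ) :
    h.coinvariantFunctional b l hl (Ideal.Quotient.mk _ f) =
      constantCoeff (wordOperator b l f) := rfl

theorem coinvariantRep_mk (w : W) (f : MvPolynomial ι ℂ) :
    coinvariantRep b W w (Ideal.Quotient.mk _ f) =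
      Ideal.Quotient.mk _ (polyAct b (w : V ≃ₗᵢ[ℝ] V) f) := rfl

/-- The degree `d` part of the space of equivariant maps from the permutation representation on
an orbit to the coinvariant algebra. -/
noncomputable abbrev orbitHom (W : Subgroup (V ≃ₗᵢ[ℝ] V)) (β : V) (d : ℕ) :
    Submodule ℂ (MonoidAlgebra ℂ (MulAction.orbit W β) →ₗ[ℂ] Coinvariant b W) :=
  equivariantHom b W (Representation.ofMulAction ℂ W (MulAction.orbit W β)) d

theorem orbitHom_apply_single_smul {d : ℕ} {φ : MonoidAlgebra ℂ (MulAction.orbit W β) →ₗ[ℂ] Coinvariant b W}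
    (hφ : φ ∈ orbitHom b W β d) (w : W) (α : MulAction.orbit W β) (c : ℂ) :
    φ (MonoidAlgebra.single (w • α) c) = coinvariantRep b W w (φ (MonoidAlgebra.single α c)) := by
  rw [← Representation.ofMulAction_single]
  exact LinearMap.congr_fun (hφ.1 w) _

/-- Evaluation of an equivariant map at `ξ`, followed by the functionals of the minimal words of
length `d`. -/
noncomputable def MinimalWords.detect (hm : MinimalWords Φ C ξ word) (h : ChamberData W Φ C x)
    (d : ℕ) : orbitHom b W β d →ₗ[ℂ] ({α // (word α).length = d} → ℂ) :=
  LinearMap.pi fun α => h.coinvariantFunctional b (word α) (hm.simple α) ∘ₗ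
    LinearMap.applyₗ (MonoidAlgebra.single ξ 1) ∘ₗ Submodule.subtype _

/-- Averaging over the isotropy group turns a homogeneous lift of φ(ξ) into an invariant one without
changing its class. If the minimal words vanish on it, all words of length d do, so φ(ξ) = 0; and ξ
generates the permutation module. -/
theorem MinimalWords.detect_injective (hm : MinimalWords Φ C ξ word) (h : ChamberData W Φ C x)
    (hξ : (ξ : V) ∈ closure C) (d : ℕ) : Function.Injective (hm.detect b h d) := by
  refine (injective_iff_map_eq_zero _).2 ?_
  rintro ⟨φ, hφ⟩ h0
  obtain ⟨f, hf, hfφ⟩ := hφ.2 (MonoidAlgebra.single ξ 1)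
  change Ideal.Quotient.mk _ f = φ (MonoidAlgebra.single ξ 1) at hfφ
  have := h.group.finite
  have : Finite (isotropy W (ξ : V)) :=
    Finite.of_injective _ (Subgroup.inclusion_injective (inf_le_left : isotropy W (ξ : V) ≤ W))
  have := Fintype.ofFinite (isotropy W (ξ : V))
  have hinv : ∀ w ∈ isotropy W (ξ : V), f - polyAct b w f ∈ invariantIdeal b W := by
    intro w hw
    rw [← Ideal.Quotient.eq, hfφ]
    have hfix : (⟨w, hw.1⟩ : W) • ξ = ξ := Subtype.ext hw.2
    have := orbitHom_apply_single_smul b hφ ⟨w, hw.1⟩ ξ 1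
    rw [hfix, ← hfφ] at this
    rw [← hfφ]
    exact this
  have hmk : Ideal.Quotient.mk _ (average b (isotropy W (ξ : V)) f) = φ (MonoidAlgebra.single ξ 1) := by
    rw [← hfφ, eq_comm, Ideal.Quotient.eq]
    exact sub_average_mem b _ hinv
  have hmem : average b (isotropy W (ξ : V)) f ∈ invariantIdeal b W := by
    refine h.mem_invariantIdeal b (isHomogeneous_average b _ hf) fun l hl hlen =>
      hm.constantCoeff_wordOperator_eq_zero b h hξ
        (fun w hw => polyAct_average b _ hw f) (fun α hα => ?_) hl hlen
    rw [← h.coinvariantFunctional_mk b _ (hm.simple α), hmk]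
    exact congrFun h0 ⟨α, hα⟩
  rw [← Ideal.Quotient.eq_zero_iff_mem, hmk] at hmem
  refine Subtype.ext (MonoidAlgebra.lhom_ext' fun α => LinearMap.ext fun c => ?_)
  obtain ⟨w, rfl⟩ := MulAction.exists_smul_eq W ξ α
  change φ (MonoidAlgebra.single _ c) = 0
  rw [orbitHom_apply_single_smul b hφ, ← mul_one c, ← smul_eq_mul, ← MonoidAlgebra.smul_single, map_smul,
    hmem, smul_zero, map_zero]

theorem MinimalWords.finite_orbitHom [Finite (MulAction.orbit W β)]
    (hm : MinimalWords Φ C ξ word) (h : ChamberData W Φ C x)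
    (hξ : (ξ : V) ∈ closure C) (d : ℕ) : Module.Finite ℂ (orbitHom b W β d) :=
  Module.Finite.of_injective _ (hm.detect_injective b h hξ d)

theorem MinimalWords.finrank_orbitHom_le [Fintype (MulAction.orbit W β)]
    (hm : MinimalWords Φ C ξ word) (h : ChamberData W Φ C x)
    (hξ : (ξ : V) ∈ closure C) (d : ℕ) :
    Module.finrank ℂ (orbitHom b W β d) ≤ Fintype.card {α // (word α).length = d} := by
  have := LinearMap.finrank_le_finrank_of_injective (hm.detect_injective b h hξ d)
  rwa [Module.finrank_fintype_fun_eq_card] at this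

end UpperBound

/-! ### Lower bound by evaluation on a regular orbit. -/

section LowerBound

open MvPolynomial

variable {V : Type*} [NormedAddCommGroup V] [InnerProductSpace ℝ V]
  {ι : Type*} [Fintype ι] (b : Module.Basis ι ℝ V)

/-- The homogeneous polynomials of degree `d` invariant under a group of isometries. -/
def homogeneousInvariants (H : Subgroup (V ≃ₗᵢ[ℝ] V)) (d : ℕ) :
    Submodule ℂ (MvPolynomial ι ℂ) where
  carrier := {f | f.IsHomogeneous d ∧ ∀ w ∈ H, polyAct b w f = f}
  add_mem' := fun hf hg => ⟨hf.1.add hg.1, fun w hw => by rw [map_add, hf.2 w hw, hg.2 w hw]⟩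
  zero_mem' := ⟨isHomogeneous_zero _ _ _, fun _ _ => map_zero _⟩
  smul_mem' := fun c f hf => ⟨by rw [smul_eq_C_mul]; exact hf.1.C_mul c,
    fun w hw => by rw [map_smul, hf.2 w hw]⟩

variable {W : Subgroup (V ≃ₗᵢ[ℝ] V)} {Φ C : Set V} {x β : V} {ξ : MulAction.orbit W β}
  {word : MulAction.orbit W β → List V}

/-- Evaluation of polynomials on the translates of `x` by the inverses of the minimal words. -/
noncomputable def orbitEval (x : V) (word : MulAction.orbit W β → List V) :
    MvPolynomial ι ℂ →ₗ[ℂ] (MulAction.orbit W β → ℂ) :=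
  LinearMap.pi fun α => (evalAt b ((reflProd (word α))⁻¹ x)).toLinearMap

theorem orbitEval_apply (x : V) (word : MulAction.orbit W β → List V) (f : MvPolynomial ι ℂ)
    (α : MulAction.orbit W β) :
    orbitEval b x word f α = evalAt b ((reflProd (word α))⁻¹ x) f := rfl

/-- The values on the orbit of the invariants of degree less than `d` of the isotropy group. -/
noncomputable def evalFiltration (x : V) (ξ : MulAction.orbit W β)
    (word : MulAction.orbit W β → List V) (d : ℕ) : Submodule ℂ (MulAction.orbit W β → ℂ) :=
  ⨆ e, ⨆ _ : e < d, (homogeneousInvariants b (isotropy W (ξ : V)) e).map (orbitEval b x word)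

theorem mem_evalFiltration {d e : ℕ} (he : e < d) {f : MvPolynomial ι ℂ}
    (hf : f ∈ homogeneousInvariants b (isotropy W (ξ : V)) e) :
    orbitEval b x word f ∈ evalFiltration b x ξ word d :=
  Submodule.mem_iSup_of_mem e (Submodule.mem_iSup_of_mem he (Submodule.mem_map_of_mem hf))

namespace MinimalWords

theorem orbitEval_invariant_mul (hm : MinimalWords Φ C ξ word) (h : ChamberData W Φ C x)
    {r : MvPolynomial ι ℂ} (hr : ∀ w ∈ W, polyAct b w r = r) (f : MvPolynomial ι ℂ) :
    orbitEval b x word (r * f) = evalAt b x r • orbitEval b x word f := by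
  funext α
  rw [Pi.smul_apply, orbitEval_apply, orbitEval_apply, map_mul, smul_eq_mul, ← evalAt_polyAct,
    hr _ (hm.mem h α)]

/-- For an invariant r without constant term and g of degree e, the degree d part of g r is g r_k
with k = d - e > 0. Averaging leaves r_k outside, and on the orbit of x it is the constant r_k(x),
so only the average of g, of degree e < d, contributes. -/
theorem orbitEval_average_mem (hm : MinimalWords Φ C ξ word) (h : ChamberData W Φ C x)
    [Fintype (isotropy W (ξ : V))] {f : MvPolynomial ι ℂ} (hf : f ∈ invariantIdeal b W) (d : ℕ) :
    orbitEval b x word (average b (isotropy W (ξ : V)) (homogeneousComponent d f)) ∈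
      evalFiltration b x ξ word d := by
  suffices ∀ g, orbitEval b x word
      (average b (isotropy W (ξ : V)) (homogeneousComponent d (g * f))) ∈
        evalFiltration b x ξ word d by simpa using this 1
  induction hf using Submodule.span_induction with
  | mem r hr =>
    intro g
    rw [← sum_homogeneousComponent g, Finset.sum_mul, map_sum, map_sum, map_sum]
    refine Submodule.sum_mem _ fun e _ => ?_
    have hg := homogeneousComponent_isHomogeneous e g
    rcases lt_or_ge d e with hde | hde
    · rw [homogeneousComponent_mul_of_lt hg hde, map_zero, map_zero]
      exact Submodule.zero_mem _
    obtain ⟨k, rfl⟩ := Nat.exists_eq_add_of_le hde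
    rw [homogeneousComponent_mul_of_left hg]
    rcases Nat.eq_zero_or_pos k with rfl | hk
    · rw [homogeneousComponent_zero, ← constantCoeff_eq, hr.2, C_0, mul_zero, map_zero, map_zero]
      exact Submodule.zero_mem _
    have hrk : ∀ w ∈ W, polyAct b w (homogeneousComponent k r) = homogeneousComponent k r :=
      fun w hw => by rw [← homogeneousComponent_polyAct, hr.1 w hw]
    rw [mul_comm, average_invariant_mul b (isotropy W (ξ : V)) fun w hw => hrk w hw.1,
      hm.orbitEval_invariant_mul b h hrk]
    exact Submodule.smul_mem _ _ (mem_evalFiltration b (by omega)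
      ⟨isHomogeneous_average b _ hg, fun w hw => polyAct_average b _ hw _⟩)
  | zero => intro g; simp
  | add p q _ _ hp hq =>
    intro g
    rw [mul_add, map_add, map_add, map_add]
    exact Submodule.add_mem _ (hp g) (hq g)
  | smul a p _ hp => intro g; rw [smul_eq_mul, ← mul_assoc]; exact hp _

/-- The equivariant map on the orbit induced by an invariant of the isotropy group. -/
noncomputable def inducedHom (hm : MinimalWords Φ C ξ word) (h : ChamberData W Φ C x) (d : ℕ) :
    homogeneousInvariants b (isotropy W (ξ : V)) d →ₗ[ℂ] orbitHom b W β d where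
  toFun f := ⟨Finsupp.linearCombination ℂ
        (fun α => Ideal.Quotient.mk (invariantIdeal b W) (polyAct b (reflProd (word α)) f)) ∘ₗ
        (MonoidAlgebra.coeffLinearEquiv ℂ).toLinearMap, by
    constructor
    · intro w
      refine MonoidAlgebra.lhom_ext' fun α => LinearMap.ext fun c => ?_
      simp only [LinearMap.comp_apply, MonoidAlgebra.lsingle_apply,
        Representation.ofMulAction_single, LinearEquiv.coe_coe,
        MonoidAlgebra.coeffLinearEquiv_apply, MonoidAlgebra.coeff_single,
        Finsupp.linearCombination_single, map_smul, coinvariantRep_mk]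
      have hw : (w * reflProd (word α)) ξ = (w • α : MulAction.orbit W β) := by
        change w.1 (reflProd (word α) ξ) = w.1 α
        rw [hm.map]
      -- w times the representative of α differs from the representative of w α by an element of the
      -- isotropy group, which fixes f.
      obtain ⟨v, hv, hprod⟩ := hm.exists_eq_mul h (W.mul_mem w.2 (hm.mem h α)) hw
      rw [← AlgHom.comp_apply (polyAct b _), ← polyAct_mul, hprod, polyAct_mul,
        AlgHom.comp_apply, f.2.2 v hv]
    · intro u
      rw [LinearMap.comp_apply, Finsupp.linearCombination_apply]
      exact Submodule.sum_mem _ fun α _ => Submodule.smul_mem _ _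
        (Submodule.mem_map_of_mem (isHomogeneous_polyAct b f.2.1 _))⟩
  map_add' f g := Subtype.ext <| MonoidAlgebra.lhom_ext' fun α => LinearMap.ext fun c => by
    simp
  map_smul' a f := Subtype.ext <| MonoidAlgebra.lhom_ext' fun α => LinearMap.ext fun c => by
    simp only [SetLike.val_smul, map_smul, LinearMap.comp_apply, MonoidAlgebra.lsingle_apply,
      LinearEquiv.coe_coe, MonoidAlgebra.coeffLinearEquiv_apply, MonoidAlgebra.coeff_single,
      Finsupp.linearCombination_single, RingHom.id_apply, LinearMap.smul_apply]
    rw [smul_comm a c]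
    exact congrArg (c • ·) (map_smul (Ideal.Quotient.mkₐ ℂ (invariantIdeal b W)) a _)

theorem inducedHom_apply_single (hm : MinimalWords Φ C ξ word) (h : ChamberData W Φ C x) (d : ℕ)
    (f : homogeneousInvariants b (isotropy W (ξ : V)) d) (α : MulAction.orbit W β) :
    (hm.inducedHom b h d f : MonoidAlgebra ℂ (MulAction.orbit W β) →ₗ[ℂ] Coinvariant b W)
      (MonoidAlgebra.single α 1) = Ideal.Quotient.mk _ (polyAct b (reflProd (word α)) f) := by
  simp [inducedHom]

theorem mem_invariantIdeal_of_inducedHom (hm : MinimalWords Φ C ξ word)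
    (h : ChamberData W Φ C x) (d : ℕ) {f : homogeneousInvariants b (isotropy W (ξ : V)) d}
    (hf : hm.inducedHom b h d f = 0) : (f : MvPolynomial ι ℂ) ∈ invariantIdeal b W := by
  have h1 := hm.inducedHom_apply_single b h d f ξ
  rw [hf, f.2.2 _ ⟨hm.mem h ξ, hm.map ξ⟩] at h1
  exact Ideal.Quotient.eq_zero_iff_mem.1 h1.symm

theorem finrank_evalFiltration_succ_le [Finite (MulAction.orbit W β)]
    (hm : MinimalWords Φ C ξ word) (h : ChamberData W Φ C x) (hξ : (ξ : V) ∈ closure C)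
    [Fintype (isotropy W (ξ : V))] (d : ℕ) :
    Module.finrank ℂ (evalFiltration b x ξ word (d + 1)) ≤
      Module.finrank ℂ (evalFiltration b x ξ word d) + Module.finrank ℂ (orbitHom b W β d) := by
  have := hm.finite_orbitHom b h hξ d
  -- The kernel consists of polynomials in the ideal, whose values come from lower degree; only a
  -- complement, which embeds in `orbitHom`, can contribute new values.
  obtain ⟨H, hH⟩ := (LinearMap.ker (hm.inducedHom b h d)).exists_isCompl
  have hinj : Function.Injective ((hm.inducedHom b h d).domRestrict H) := by
    refine (injective_iff_map_eq_zero _).2 fun f hf => ?_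
    have := (Submodule.disjoint_def.1 hH.disjoint) f (LinearMap.mem_ker.2 hf) f.2
    exact Subtype.ext this
  have : Module.Finite ℂ H := Module.Finite.of_injective
    (hm.detect b h d ∘ₗ (hm.inducedHom b h d).domRestrict H)
    ((hm.detect_injective b h hξ d).comp hinj)
  let E := orbitEval b x word ∘ₗ (homogeneousInvariants b (isotropy W (ξ : V)) d).subtype
  have hle : evalFiltration b x ξ word (d + 1) ≤ evalFiltration b x ξ word d ⊔ H.map E := by
    refine iSup₂_le fun e he => ?_
    rcases Nat.lt_succ_iff_lt_or_eq.1 he with he | rfl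
    · exact le_trans (le_iSup₂_of_le e he le_rfl) le_sup_left
    · rintro _ ⟨f, hf, rfl⟩
      have htop : (⟨f, hf⟩ : homogeneousInvariants b (isotropy W (ξ : V)) e) ∈
          LinearMap.ker (hm.inducedHom b h e) ⊔ H := by
        rw [hH.sup_eq_top]; exact Submodule.mem_top
      obtain ⟨k, hk, g, hg, hkg⟩ := Submodule.mem_sup.1 htop
      have hf' : f = (k : MvPolynomial ι ℂ) + g := congrArg Subtype.val hkg.symm
      rw [hf', map_add]
      refine Submodule.add_mem_sup ?_ ⟨g, hg, rfl⟩
      have hkI := hm.mem_invariantIdeal_of_inducedHom b h e (LinearMap.mem_ker.1 hk)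
      have := hm.orbitEval_average_mem b h hkI e
      rwa [homogeneousComponent_eq_self k.2.1, average_of_invariant b _ k.2.2] at this
  refine (Submodule.finrank_mono hle).trans ((Submodule.finrank_add_le_finrank_add_finrank _ _).trans
    (Nat.add_le_add_left ?_ _))
  exact (Submodule.finrank_map_le E H).trans (LinearMap.finrank_le_finrank_of_injective hinj)

theorem finrank_evalFiltration_le [Finite (MulAction.orbit W β)]
    (hm : MinimalWords Φ C ξ word) (h : ChamberData W Φ C x) (hξ : (ξ : V) ∈ closure C)
    [Fintype (isotropy W (ξ : V))] (D : ℕ) :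
    Module.finrank ℂ (evalFiltration b x ξ word D) ≤
      ∑ d ∈ Finset.range D, Module.finrank ℂ (orbitHom b W β d) := by
  induction D with
  | zero =>
    have : evalFiltration b x ξ word 0 = ⊥ := by simp [evalFiltration]
    rw [this, finrank_bot]
    exact Nat.zero_le _
  | succ d ih =>
    rw [Finset.sum_range_succ]
    exact (hm.finrank_evalFiltration_succ_le b h hξ d).trans (Nat.add_le_add_right ih _)

theorem exists_orbitEval_eq_single [DecidableEq (MulAction.orbit W β)]
    (hm : MinimalWords Φ C ξ word) (h : ChamberData W Φ C x)
    [Fintype (isotropy W (ξ : V))] (α : MulAction.orbit W β) :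
    ∃ f : MvPolynomial ι ℂ, (∀ w ∈ isotropy W (ξ : V), polyAct b w f = f) ∧
      orbitEval b x word f = Pi.single α 1 := by
  classical
  have := h.group.finite
  have := Fintype.ofFinite W
  obtain ⟨p, hp⟩ := exists_evalAt_eq b
    (Finset.univ.image fun w : W => (w : V ≃ₗᵢ[ℝ] V)⁻¹ x)
    (fun y => if ∃ u ∈ W, y = u⁻¹ x ∧ u ξ = α then 1 else 0)
  -- The prescribed values are consistent because x is regular: u⁻¹ x determines u.
  have hp' : ∀ u ∈ W, evalAt b (u⁻¹ x) p = if u ξ = α then 1 else 0 := by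
    intro u hu
    rw [hp _ (Finset.mem_image.2 ⟨⟨u, hu⟩, Finset.mem_univ _, rfl⟩)]
    refine if_congr ⟨?_, fun hα => ⟨u, hu, rfl, hα⟩⟩ rfl rfl
    rintro ⟨v, hv, huv, hα⟩
    have h1 : (v * u⁻¹) x = x := by
      change v (u⁻¹ x) = x
      rw [huv, apply_inv_self]
    have h2 := h.eq_one_of_map_mem (W.mul_mem hv (W.inv_mem hu)) h1
    rwa [← mul_inv_eq_one.1 h2]
  refine ⟨average b (isotropy W (ξ : V)) p, fun w hw => polyAct_average b _ hw _, ?_⟩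
  funext γ
  rw [orbitEval_apply, evalAt_average]
  have key : ∀ v : isotropy W (ξ : V),
      evalAt b ((v : V ≃ₗᵢ[ℝ] V)⁻¹ ((reflProd (word γ))⁻¹ x)) p = if γ = α then 1 else 0 := by
    intro v
    have hvξ : (v : V ≃ₗᵢ[ℝ] V) ξ = ξ := v.2.2
    have := hp' (reflProd (word γ) * v) (W.mul_mem (hm.mem h γ) v.2.1)
    rw [mul_inv_rev] at this
    refine this.trans (if_congr ?_ rfl rfl)
    change reflProd (word γ) ((v : V ≃ₗᵢ[ℝ] V) ξ) = α ↔ _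
    rw [hvξ, hm.map, Subtype.coe_inj]
  rw [Finset.sum_congr rfl fun v _ => key v, Finset.sum_const, Finset.card_univ, nsmul_eq_mul,
    ← mul_assoc, card_inv_mul_card, one_mul, Pi.single_apply]

theorem exists_evalFiltration_eq_top [Finite (MulAction.orbit W β)]
    (hm : MinimalWords Φ C ξ word) (h : ChamberData W Φ C x)
    [Fintype (isotropy W (ξ : V))] :
    ∃ D₀, ∀ D, D₀ ≤ D → evalFiltration b x ξ word D = ⊤ := by
  classical
  have := Fintype.ofFinite (MulAction.orbit W β)
  choose f hf hfE using hm.exists_orbitEval_eq_single b h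
  refine ⟨Finset.univ.sup (fun α => (f α).totalDegree) + 1, fun D hD => ?_⟩
  rw [eq_top_iff, ← (Pi.basisFun ℂ (MulAction.orbit W β)).span_eq, Submodule.span_le]
  rintro _ ⟨α, rfl⟩
  rw [Pi.basisFun_apply, ← hfE α, ← sum_homogeneousComponent (f α), map_sum]
  refine Submodule.sum_mem _ fun e he => mem_evalFiltration b ?_
    ⟨homogeneousComponent_isHomogeneous e _, fun w hw => by
      rw [← homogeneousComponent_polyAct, hf α w hw]⟩
  have h1 : (f α).totalDegree ≤ Finset.univ.sup (fun α => (f α).totalDegree) :=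
    Finset.le_sup (f := fun α => (f α).totalDegree) (Finset.mem_univ α)
  have := Finset.mem_range.1 he
  omega

/-- The degree `d` part of `Hom_W(ℂΦ', S/I)` has the number of orbit elements of minimal length
`d` as its dimension. -/
theorem finrank_orbitHom [Fintype (MulAction.orbit W β)]
    (hm : MinimalWords Φ C ξ word) (h : ChamberData W Φ C x) (hξ : (ξ : V) ∈ closure C) (d : ℕ) :
    Module.finrank ℂ (orbitHom b W β d) = Fintype.card {α // (word α).length = d} := by
  have := h.group.finite
  have : Finite (isotropy W (ξ : V)) :=
    Finite.of_injective _ (Subgroup.inclusion_injective (inf_le_left : isotropy W (ξ : V) ≤ W))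
  have := Fintype.ofFinite (isotropy W (ξ : V))
  obtain ⟨D₀, hD₀⟩ := hm.exists_evalFiltration_eq_top b h
  -- Large enough for the filtration to be everything and for degree d to occur in the sum.
  set D := max D₀ (d + 1) with hD
  have h1 := hm.finrank_evalFiltration_le b h hξ D
  rw [hD₀ D (le_max_left _ _), finrank_top, Module.finrank_fintype_fun_eq_card] at h1
  have h2 : ∑ e ∈ Finset.range D, Fintype.card {α // (word α).length = e} ≤
      Fintype.card (MulAction.orbit W β) := by
    classical
    simp only [Fintype.card_subtype]
    rw [← Finset.card_biUnion]
    · exact Finset.card_le_univ _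
    · intro i _ j _ hij
      rw [Function.onFun, Finset.disjoint_filter]
      rintro α - rfl
      exact hij
  have h3 : ∀ e ∈ Finset.range D, Module.finrank ℂ (orbitHom b W β e) ≤
      Fintype.card {α // (word α).length = e} := fun e _ => hm.finrank_orbitHom_le b h hξ e
  -- The termwise upper bounds sum to at most the size of the orbit, which the dimensions already
  -- reach, so every bound is attained.
  exact (Finset.sum_eq_sum_iff_of_le h3).1
    (le_antisymm (Finset.sum_le_sum h3) (h2.trans h1)) d (Finset.mem_range.2 (by omega))

end MinimalWords

end LowerBound

/-! ### Length generating functions and the coset factorization. -/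

section GeneratingFunctions

variable {V : Type*} [NormedAddCommGroup V] [InnerProductSpace ℝ V]
  {W : Subgroup (V ≃ₗᵢ[ℝ] V)} {Φ C : Set V} {x β : V} {ξ : MulAction.orbit W β}
  {word : MulAction.orbit W β → List V}

theorem finsum_orbit_eq [Fintype (MulAction.orbit W β)] (hm : MinimalWords Φ C ξ word) :
    (∑ᶠ α ∈ MulAction.orbit W β, (Polynomial.X : ℤ[X]) ^
      minLength (simpleReflections Φ C) W (ξ : V) α) =
      ∑ α : MulAction.orbit W β, Polynomial.X ^ (word α).length := by
  rw [← finsum_set_coe_eq_finsum_mem, finsum_eq_sum_of_fintype]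
  exact Finset.sum_congr rfl fun α _ => by rw [hm.length_eq]

theorem lengthPolynomial_eq_sum (S : Set (V ≃ₗᵢ[ℝ] V)) (H : Subgroup (V ≃ₗᵢ[ℝ] V)) [Fintype H] :
    lengthPolynomial S H = ∑ w : H, Polynomial.X ^ wordLength S (w : V ≃ₗᵢ[ℝ] V) := by
  rw [lengthPolynomial, ← finsum_eq_sum_of_fintype]
  exact (finsum_set_coe_eq_finsum_mem (H : Set (V ≃ₗᵢ[ℝ] V))).symm

/-- The factorization of `W` into minimal coset representatives and the isotropy group. -/
noncomputable def MinimalWords.factorization (hm : MinimalWords Φ C ξ word)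
    (h : ChamberData W Φ C x) :
    MulAction.orbit W β × isotropy W (ξ : V) ≃ W :=
  Equiv.ofBijective
    (fun p => ⟨reflProd (word p.1) * p.2, W.mul_mem (hm.mem h p.1) p.2.2.1⟩) <| by
    have hmap : ∀ p : MulAction.orbit W β × isotropy W (ξ : V),
        (reflProd (word p.1) * (p.2 : V ≃ₗᵢ[ℝ] V)) ξ = p.1 := by
      intro p
      have : (p.2 : V ≃ₗᵢ[ℝ] V) ξ = ξ := p.2.2.2
      change reflProd (word p.1) ((p.2 : V ≃ₗᵢ[ℝ] V) ξ) = _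
      rw [this, hm.map]
    constructor
    · intro p q hpq
      have hval : reflProd (word p.1) * (p.2 : V ≃ₗᵢ[ℝ] V) = reflProd (word q.1) * q.2 :=
        congrArg Subtype.val hpq
      have h1 : p.1 = q.1 := Subtype.ext (by rw [← hmap p, ← hmap q, hval])
      rw [h1] at hval
      exact Prod.ext h1 (Subtype.ext (mul_left_cancel hval))
    · intro w
      obtain ⟨v, hv, hw⟩ := hm.exists_eq_mul h w.2 (α := w • ξ) rfl
      exact ⟨(w • ξ, ⟨v, hv⟩), Subtype.ext hw.symm⟩

theorem MinimalWords.sum_mul_lengthPolynomial [Fintype (MulAction.orbit W β)]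
    (hm : MinimalWords Φ C ξ word) (h : ChamberData W Φ C x) (hξ : (ξ : V) ∈ closure C) :
    (∑ α : MulAction.orbit W β, (Polynomial.X : ℤ[X]) ^ (word α).length) *
        lengthPolynomial (simpleReflections Φ C) (isotropy W (ξ : V)) =
      lengthPolynomial (simpleReflections Φ C) W := by
  have := h.group.finite
  have : Finite (isotropy W (ξ : V)) :=
    Finite.of_injective _ (Subgroup.inclusion_injective (inf_le_left : isotropy W (ξ : V) ≤ W))
  have := Fintype.ofFinite (isotropy W (ξ : V))
  have := Fintype.ofFinite W
  rw [lengthPolynomial_eq_sum, lengthPolynomial_eq_sum, Finset.sum_mul_sum,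
    ← Fintype.sum_prod_type', ← Equiv.sum_comp (hm.factorization h)]
  refine Finset.sum_congr rfl fun p _ => ?_
  rw [← pow_add, ← hm.wordLength_mul h hξ p.1 p.2.2]
  rfl

end GeneratingFunctions

end FakeDegree

/-! ### The main theorem. -/

theorem proposition3p1 {V : Type*} [NormedAddCommGroup V] [InnerProductSpace ℝ V]
    {ι : Type*} [Fintype ι] (b : Module.Basis ι ℝ V)
    (W : Subgroup (V ≃ₗᵢ[ℝ] V)) (hW : FakeDegree.IsFiniteReflectionGroup W)
    (Φ : Set V) (hΦ : FakeDegree.IsRootSystemOf W Φ)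
    (C : Set V) (hC : FakeDegree.IsChamber Φ C)
    (β : V) (hβ : β ∈ Φ) :
    -- the orbit of `β` has a unique dominant element
    (∃! α₀ : V, α₀ ∈ MulAction.orbit W β ∧ α₀ ∈ closure C) ∧
    ∀ α₀ ∈ MulAction.orbit W β, α₀ ∈ closure C →
      -- the isotropy group of `α₀` is a standard parabolic subgroup
      (∃ J ⊆ FakeDegree.simpleReflections Φ C,
        FakeDegree.isotropy W α₀ = Subgroup.closure J) ∧
      -- each coset of the isotropy group has a unique representative of minimal length
      (∀ α ∈ MulAction.orbit W β, ∃! w : V ≃ₗᵢ[ℝ] V, (w ∈ W ∧ w • α₀ = α) ∧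
        FakeDegree.wordLength (FakeDegree.simpleReflections Φ C) w =
          FakeDegree.minLength (FakeDegree.simpleReflections Φ C) W α₀ α) ∧
      -- the fake degree as a sum over the orbit
      FakeDegree.orbitFakeDegree b W β =
        ((∑ᶠ α ∈ MulAction.orbit W β,
          (Polynomial.X : Polynomial ℤ) ^
            FakeDegree.minLength (FakeDegree.simpleReflections Φ C) W α₀ α :
          Polynomial ℤ) : PowerSeries ℤ) ∧
      -- the fake degree as a quotient of length generating functions
      FakeDegree.orbitFakeDegree b W β *
          (FakeDegree.lengthPolynomial (FakeDegree.simpleReflections Φ C)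
            (FakeDegree.isotropy W α₀) : PowerSeries ℤ) =
        (FakeDegree.lengthPolynomial (FakeDegree.simpleReflections Φ C) W :
          PowerSeries ℤ) := by
  obtain ⟨x, hx, hCx⟩ := hC
  have h : FakeDegree.ChamberData W Φ C x := ⟨hW, hΦ, hCx, hx⟩
  constructor
  · obtain ⟨w, hw, hwβ⟩ := h.exists_dominant β
    refine ⟨w β, ⟨⟨⟨w, hw⟩, rfl⟩, hwβ⟩, ?_⟩
    rintro γ ⟨hγ, hγC⟩
    obtain ⟨u, hu, huγ⟩ := FakeDegree.exists_mem_map_eq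
      (⟨w β, ⟨w, hw⟩, rfl⟩ : MulAction.orbit W β) ⟨γ, hγ⟩
    change u (w β) = γ at huγ
    rw [← huγ] at hγC ⊢
    exact (h.dominant_unique hwβ _ hu hγC le_rfl).1
  · intro α₀ hα₀ hα₀C
    lift α₀ to MulAction.orbit W β using hα₀ with ξ
    obtain ⟨word, hm⟩ := h.exists_minimalWords ξ
    have := hW.finite
    have : Finite (MulAction.orbit W β) := Set.finite_range _
    have := Fintype.ofFinite (MulAction.orbit W β)
    have hfake : FakeDegree.orbitFakeDegree b W β =
        ((∑ α : MulAction.orbit W β, Polynomial.X ^ (word α).length : Polynomial ℤ) :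
          PowerSeries ℤ) := by
      ext d
      rw [FakeDegree.orbitFakeDegree, FakeDegree.fakeDegree, PowerSeries.coeff_mk,
        Polynomial.coeff_coe, Polynomial.finsetSum_coeff, hm.finrank_orbitHom b h hα₀C d,
        Fintype.card_subtype]
      simp [Polynomial.coeff_X_pow, eq_comm]
    refine ⟨⟨_, ?_, h.isotropy_eq_closure hα₀C⟩, ?_, ?_, ?_⟩
    · exact Set.image_mono fun α hα => hα.1
    · intro α hα
      refine ⟨FakeDegree.reflProd (word ⟨α, hα⟩), ⟨⟨hm.mem h _, hm.map ⟨α, hα⟩⟩, ?_⟩, ?_⟩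
      · rw [hm.reduced, hm.length_eq]
      · rintro w ⟨⟨hw, hwα⟩, hlen⟩
        exact hm.eq_of_wordLength_eq h hα₀C hw (α := ⟨α, hα⟩) hwα hlen
    · rw [hfake, FakeDegree.finsum_orbit_eq hm]
    · rw [hfake, ← Polynomial.coe_mul, hm.sum_mul_lengthPolynomial h hα₀C]
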